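/- Fix $\beta>0$ and, for each $n\ge 2$, an integer $m(n)$ with $1\le m(n)\le n-1$, such that $$\frac{m(n)}{n/\log n}\longrightarrow 0\qquad(n\to\infty).$$ Let $\mu$ be a (deterministic) probability measure on $\mathbb C$ with at least polynomially decaying tail, i.e. there exists $c>0$ with $$\sup_{R\ge 1} R^{c}\,\mu(\{z\in\mathbb C:\ |z|>R\})<\infty .$$ On a probability space, let, for each $n\ge 2$, $(Z^{(n,0)}_k)_{1\le k\le n}$ be i.i.d. random variables with distribution $\mu$, and let $(\gamma^{(n,j)}_k)_{1\le j\le m(n),\,1\le k\le n+1-j}$ be i.i.d. random variables with the Gamma distribution of parameter $\beta/2$ (density $\Gamma(\beta/2)^{-1}t^{\beta/2-1}e^{-t}$ on $t>0$), independent of $(Z^{(n,0)}_k)_{1\le k\le n}$; nothing is assumed on the joint law for different $n$. For $1\le j\le m(n)$, define inductively $(Z^{(n,j)}_k)_{1\le k\le n-j}$ as the almost surely $n-j$ zeros, counted with multiplicity, of the polynomial $$z\mapsto\sum_{k=1}^{n+1-j}\gamma^{(n,j)}_k\prod_{1\le \ell\le n+1-j,\ \ell\ne k}\bigl(z-Z^{(n,j-1)}_\ell\bigr),$$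 where the zeros may be numbered in any way for which each $Z^{(n,j)}_k$ is a measurable function of the initial points $(Z^{(n,0)}_\ell)_\ell$ and of the weights $(\gamma^{(n,i)}_\ell)_{i\le j,\,\ell}$ of the first $j$ steps. Let $$\mu_{n,m(n)}:=\frac1{n-m(n)}\sum_{k=1}^{n-m(n)}\delta_{Z^{(n,m(n))}_k}.$$ Then, almost surely, $\mu_{n,m(n)}$ converges weakly to $\mu$ as $n\to\infty$ (that is, almost surely $\int f\,d\mu_{n,m(n)}\to\int f\,d\mu$ for every bounded continuous $f$). -/

import Mathlib

open MeasureTheory ProbabilityTheory Filter Topology Polynomial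

noncomputable section

/-- The randomized derivative of `∏ ℓ, (X - z ℓ)` with weights `g`:
the polynomial `∑ k, g k * ∏ ℓ ≠ k, (X - z ℓ)`. -/
def randomizedDerivative {d : ℕ} (z : Fin d → ℂ) (g : Fin d → ℝ) : ℂ[X] :=
  ∑ k : Fin d, C (g k : ℂ) * ∏ l ∈ Finset.univ.erase k, (X - C (z l))

/-- The finite family `w` enumerates the complex zeros of the nonzero polynomial `p`,
counted with multiplicity (in some order). -/
def EnumeratesZeros {d : ℕ} (w : Fin d → ℂ) (p : ℂ[X]) : Prop :=
  p ≠ 0 ∧ p.roots = Finset.univ.val.map w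

/-- The empirical measure `(1 / d) * ∑ k, δ_{z k}` (a probability measure as soon as `d ≠ 0`);
the topology of `FiniteMeasure ℂ` is that of weak convergence, i.e. convergence of the integrals
of all bounded continuous functions. -/
def empiricalMeasure {d : ℕ} (z : Fin d → ℂ) : FiniteMeasure ℂ :=
  (d : NNReal)⁻¹ • ∑ k : Fin d, (diracProba (z k)).toFiniteMeasure

/-- The σ-algebra generated by the initial points `z` of one row and by the weights `g i`
of the first `j` steps. -/
abbrev pastSigmaAlgebra {Ω : Type*} {n : ℕ} (z : Fin n → Ω → ℂ)
    (g : (i : ℕ) → Fin (n - i) → Ω → ℝ) (j : ℕ) : MeasurableSpace Ω :=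
  (⨆ k : Fin n, MeasurableSpace.comap (z k) inferInstance) ⊔
    ⨆ i : Fin j, ⨆ k : Fin (n - i), MeasurableSpace.comap (g i k) inferInstance

end

/-! If `w` lists the zeros of the randomized derivative of `∏ (X - z k)`, then `(∑ g k) * ∏ (x - w
k) = (∏ (x - z k)) * S(x)`, where `S` is the weighted Cauchy sum. Taking logarithms and telescoping
over the steps, the potential `∑ log ‖x - ·‖` of the last row minus that of the first is a sum of
`m` terms `log (‖S_j(x)‖ / G_j)`, with `G_j` the total weight of step `j` (`logPotentialSub_eq`).

Each term is `O(log n)` when `x` is at distance at least `n⁻²` from the points of all rows and no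
`‖S_j(x)‖` is below a negative power of `n`. The remaining `x` fill an area `O(n⁻²)`, on which the
logarithmic singularities integrate to something negligible, because Gauss–Lucas keeps all points
within polynomial distance. Hence the potentials differ in `L¹` of a disc by `O(m log n) + o(n) =
o(n)`.

The only delicate probabilistic input is that small Cauchy sums are rare. For fixed `x`, one weight
of step `j` is independent of the current points and of the other weights, and the Gamma law gives
intervals of length `2δ` mass `O(δ ^ κ)`; so `S_j(x)` is unlikely to be near `0`
(`measure_norm_cauchySum_le`). Fubini, Markov and Borel–Cantelli turn this into an almost sure area
bound. Since every bound is summable within its own row, the joint law of different rows is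
irrelevant.

Finally, `L¹` closeness of potentials compares point counts in balls: averaging `log ‖· - a‖` over
an annulus and over a dilated copy, and subtracting, gives a function of `a` squeezed between
multiples of two ball indicators (`annularPotential_bounds`). The initial row has the right
frequencies by Hoeffding, and asymptotic lower bounds on balls suffice for weak convergence to a
probability measure (`tendsto_empiricalMeasure_of_ball`). -/

/-! ### Randomized derivatives, Cauchy sums and Gauss–Lucas -/

/-- The weighted Cauchy sum `∑ k, g k / (x - z k)`. -/
noncomputable def cauchySum {d : ℕ} (z : Fin d → ℂ) (g : Fin d → ℝ) (x : ℂ) : ℂ :=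
  ∑ k, (g k : ℂ) / (x - z k)

theorem eval_randomizedDerivative {d : ℕ} (z : Fin d → ℂ) (g : Fin d → ℝ) {x : ℂ}
    (hx : ∀ k, x ≠ z k) :
    (randomizedDerivative z g).eval x = (∏ k, (x - z k)) * cauchySum z g x := by
  simp only [randomizedDerivative, cauchySum, eval_finsetSum, eval_mul, eval_C, eval_prod,
    eval_sub, eval_X, Finset.mul_sum]
  refine Finset.sum_congr rfl fun k _ => ?_
  rw [← Finset.mul_prod_erase _ _ (Finset.mem_univ k)]
  have := sub_ne_zero.2 (hx k)
  field_simp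

theorem coeff_randomizedDerivative {e : ℕ} (z : Fin (e + 1) → ℂ) (g : Fin (e + 1) → ℝ) :
    (randomizedDerivative z g).coeff e = ((∑ k, g k : ℝ) : ℂ) := by
  simp only [randomizedDerivative, finsetSum_coeff, coeff_C_mul, Complex.ofReal_sum]
  refine Finset.sum_congr rfl fun k _ => ?_
  have hmon : (∏ l ∈ Finset.univ.erase k, (X - C (z l))).Monic :=
    monic_prod_of_monic _ _ fun l _ => monic_X_sub_C _
  have hdeg : (∏ l ∈ Finset.univ.erase k, (X - C (z l))).natDegree = e := by
    rw [natDegree_prod_of_monic _ _ fun l _ => monic_X_sub_C _]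
    simp
  have := hmon.coeff_natDegree
  rw [hdeg] at this
  rw [this, mul_one]

/-- No sign condition on the weights is needed: the root list has `e` entries, which forces degree
`e`, so the coefficient of `X ^ e` is the leading one. -/
theorem EnumeratesZeros.eval_eq {d e : ℕ} (hde : d = e + 1) {z : Fin d → ℂ} {g : Fin d → ℝ}
    {w : Fin e → ℂ} (h : EnumeratesZeros w (randomizedDerivative z g)) (x : ℂ) :
    (randomizedDerivative z g).eval x = ((∑ k, g k : ℝ) : ℂ) * ∏ k, (x - w k) := by
  subst hde
  have hs : (randomizedDerivative z g).Splits := IsAlgClosed.splits _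
  have hcard : (randomizedDerivative z g).natDegree = e := by
    rw [hs.natDegree_eq_card_roots, h.2]
    simp
  have hlead : (randomizedDerivative z g).leadingCoeff = ((∑ k, g k : ℝ) : ℂ) := by
    rw [leadingCoeff, hcard, coeff_randomizedDerivative]
  have := congrArg (eval x) hs.eq_prod_roots
  rw [this, hlead, h.2, eval_mul, eval_C, Multiset.map_map, eval_multiset_prod, Multiset.map_map]
  simp [Finset.prod]

/-- The Cauchy sum as a ratio of the products over zeros of two consecutive generations. -/
theorem EnumeratesZeros.prod_eq {d e : ℕ} (hde : d = e + 1) {z : Fin d → ℂ} {g : Fin d → ℝ}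
    {w : Fin e → ℂ} (h : EnumeratesZeros w (randomizedDerivative z g)) {x : ℂ}
    (hx : ∀ k, x ≠ z k) :
    ((∑ k, g k : ℝ) : ℂ) * ∏ k, (x - w k) = (∏ k, (x - z k)) * cauchySum z g x := by
  rw [← h.eval_eq hde, eval_randomizedDerivative z g hx]

/-- After multiplication by `x`, every summand has positive real part, because `Re (x * conj (x - z
k)) ≥ ‖x‖ ^ 2 - ‖x‖ * ‖z k‖ > 0`. -/
theorem cauchySum_ne_zero {d : ℕ} (hd : 0 < d) {z : Fin d → ℂ} {g : Fin d → ℝ}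
    (hg : ∀ k, 0 < g k) {R : ℝ} (hz : ∀ k, ‖z k‖ ≤ R) {x : ℂ} (hx : R < ‖x‖) :
    cauchySum z g x ≠ 0 := by
  intro h0
  have hpos : ∀ k, 0 < ((g k : ℂ) / (x - z k) * x).re := by
    intro k
    have hne : x - z k ≠ 0 := by
      intro h
      rw [sub_eq_zero] at h
      exact absurd (hz k) (by rw [← h]; linarith)
    have e : (g k : ℂ) / (x - z k) * x
        = ((g k / Complex.normSq (x - z k) : ℝ) : ℂ) * (x * (starRingEnd ℂ) (x - z k)) := by
      rw [div_eq_mul_inv, Complex.inv_def]; push_cast; ring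
    rw [e, Complex.re_ofReal_mul]
    refine mul_pos (div_pos (hg k) (Complex.normSq_pos.2 hne)) ?_
    have h1 : (x * (starRingEnd ℂ) (x - z k)).re = ‖x‖ ^ 2 - (x * (starRingEnd ℂ) (z k)).re := by
      rw [map_sub, mul_sub, Complex.sub_re, Complex.mul_conj, Complex.ofReal_re,
        Complex.normSq_eq_norm_sq]
    have h2 : (x * (starRingEnd ℂ) (z k)).re ≤ ‖x‖ * ‖z k‖ := by
      refine (Complex.re_le_norm _).trans ?_
      rw [norm_mul, Complex.norm_conj]
    have h3 : 0 ≤ R := (norm_nonneg _).trans (hz k)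
    nlinarith [hz k, norm_nonneg (z k)]
  have hsum : 0 < ∑ k, ((g k : ℂ) / (x - z k) * x).re :=
    Finset.sum_pos (fun k _ => hpos k) ⟨⟨0, hd⟩, Finset.mem_univ _⟩
  rw [← Complex.re_sum, ← Finset.sum_mul] at hsum
  unfold cauchySum at h0
  rw [h0] at hsum
  simp at hsum

/-- A Gauss–Lucas theorem for discs: the zeros of a randomized derivative with positive weights
stay in every centred disc that contains the original points. -/
theorem EnumeratesZeros.norm_le {d e : ℕ} (hd : 0 < d) {z : Fin d → ℂ} {g : Fin d → ℝ}
    {w : Fin e → ℂ} (h : EnumeratesZeros w (randomizedDerivative z g))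
    (hg : ∀ k, 0 < g k) {R : ℝ} (hz : ∀ k, ‖z k‖ ≤ R) (k : Fin e) : ‖w k‖ ≤ R := by
  by_contra! hlt
  have hne : ∀ l, w k ≠ z l := fun l hl => absurd (hz l) (by rw [← hl]; linarith)
  have hroot : (randomizedDerivative z g).eval (w k) = 0 := by
    have : w k ∈ (randomizedDerivative z g).roots := by rw [h.2]; simp
    exact (mem_roots'.1 this).2
  rw [eval_randomizedDerivative z g hne, mul_eq_zero] at hroot
  rcases hroot with h0 | h0
  · obtain ⟨l, -, hl⟩ := Finset.prod_eq_zero_iff.1 h0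
    exact hne l (sub_eq_zero.1 hl)
  · exact cauchySum_ne_zero hd hg hz hlt h0

/-- The Cauchy sum is at most the total weight divided by the distance to the points. -/
theorem norm_cauchySum_le {d : ℕ} {z : Fin d → ℂ} {g : Fin d → ℝ} (hg : ∀ k, 0 < g k) {x : ℂ}
    {r : ℝ} (hr : 0 < r) (hx : ∀ k, r ≤ ‖x - z k‖) : ‖cauchySum z g x‖ ≤ (∑ k, g k) / r := by
  rw [Finset.sum_div]
  refine (norm_sum_le _ _).trans (Finset.sum_le_sum fun k _ => ?_)
  rw [norm_div, Complex.norm_real, Real.norm_of_nonneg (hg k).le]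
  exact div_le_div_of_nonneg_left (hg k).le hr (hx k)

theorem measurable_cauchySum {d : ℕ} :
    Measurable fun p : (Fin d → ℂ) × (Fin d → ℝ) × ℂ => cauchySum p.1 p.2.1 p.2.2 := by
  unfold cauchySum
  refine Finset.measurable_sum _ fun k _ => ?_
  have h1 : Measurable fun p : (Fin d → ℂ) × (Fin d → ℝ) × ℂ => ((p.2.1 k : ℝ) : ℂ) :=
    Complex.measurable_ofReal.comp (by fun_prop)
  have h2 : Measurable fun p : (Fin d → ℂ) × (Fin d → ℝ) × ℂ => p.2.2 - p.1 k := by fun_prop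
  exact h1.div h2

/-! ### Integrals of logarithmic singularities in the plane -/

theorem integrableOn_inv_norm_ball :
    IntegrableOn (fun x : ℂ => ‖x‖⁻¹) (Metric.ball 0 1) := by
  rw [integrableOn_fun_norm_addHaar volume (f := fun y : ℝ => y⁻¹)]
  have : IntegrableOn (fun _ : ℝ => (1 : ℝ)) (Set.Ioo 0 1) := by simp
  refine this.congr_fun (fun y hy => ?_) measurableSet_Ioo
  have : y ≠ 0 := hy.1.ne'
  simp [Complex.finrank_real_complex, this]

/-- The integral of `1 / ‖x‖` over the unit disc. -/
noncomputable def discInvNormIntegral : ℝ := ∫ x in Metric.ball (0 : ℂ) 1, ‖x‖⁻¹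

theorem discInvNormIntegral_nonneg : 0 ≤ discInvNormIntegral :=
  integral_nonneg fun x => by positivity

theorem integrable_indicator_inv_norm_sub (a : ℂ) :
    Integrable fun x : ℂ => (Metric.ball (0 : ℂ) 1).indicator (fun x => ‖x‖⁻¹) (x - a) :=
  ((integrable_indicator_iff Metric.isOpen_ball.measurableSet).2
    integrableOn_inv_norm_ball).comp_sub_right a

theorem inv_norm_sub_le (a x : ℂ) :
    ‖x - a‖⁻¹ ≤ (Metric.ball (0 : ℂ) 1).indicator (fun x => ‖x‖⁻¹) (x - a) + 1 := by
  by_cases h : x - a ∈ Metric.ball (0 : ℂ) 1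
  · rw [Set.indicator_of_mem h]; linarith
  · rw [Set.indicator_of_notMem h, zero_add]
    have : 1 ≤ ‖x - a‖ := by simpa using h
    exact inv_le_one_of_one_le₀ this

theorem integrableOn_inv_norm_sub (a : ℂ) {s : Set ℂ} (hs : volume s ≠ ⊤) :
    IntegrableOn (fun x : ℂ => ‖x - a‖⁻¹) s := by
  refine Integrable.mono' ((integrable_indicator_inv_norm_sub a).integrableOn.add
    (integrableOn_const hs (C := (1 : ℝ)))) (by fun_prop) (ae_of_all _ fun x => ?_)
  rw [Real.norm_of_nonneg (by positivity)]
  exact inv_norm_sub_le a x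

/-- The bound is uniform in `a`: translation invariance moves the singular part to the unit disc at
the origin, and off it the integrand is at most `1`. -/
theorem setIntegral_inv_norm_sub_le (a : ℂ) {s : Set ℂ} (hs : volume s ≠ ⊤) :
    ∫ x in s, ‖x - a‖⁻¹ ≤ discInvNormIntegral + volume.real s := by
  calc ∫ x in s, ‖x - a‖⁻¹
      ≤ ∫ x in s, ((Metric.ball (0 : ℂ) 1).indicator (fun x => ‖x‖⁻¹) (x - a) + 1) :=
        integral_mono (integrableOn_inv_norm_sub a hs)
          ((integrable_indicator_inv_norm_sub a).integrableOn.add (integrableOn_const hs))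
          (inv_norm_sub_le a)
    _ = (∫ x in s, (Metric.ball (0 : ℂ) 1).indicator (fun x => ‖x‖⁻¹) (x - a))
          + volume.real s := by
        rw [integral_add (integrable_indicator_inv_norm_sub a).integrableOn
          (integrableOn_const hs)]
        simp
    _ ≤ _ := by
        gcongr
        refine (setIntegral_le_integral (integrable_indicator_inv_norm_sub a)
          (ae_of_all _ fun x => Set.indicator_nonneg (fun _ _ => by positivity) _)).trans_eq ?_
        rw [integral_sub_right_eq_self
          (fun x => (Metric.ball (0 : ℂ) 1).indicator (fun x => ‖x‖⁻¹) x) a,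
          integral_indicator Metric.isOpen_ball.measurableSet, discInvNormIntegral]

/-- The free parameter `L` trades an additive `log L` for a factor `L⁻¹` on the singularity, via
`-log y = log L + log (L⁻¹ * y⁻¹)`. Integrated over a set of tiny area with `L` large, both
contributions are small. -/
theorem abs_log_le {y M L : ℝ} (hy : 0 ≤ y) (hyM : y ≤ M) (hM : 1 ≤ M) (hL : 1 ≤ L) :
    |Real.log y| ≤ Real.log M + Real.log L + L⁻¹ * y⁻¹ := by
  have hlM := Real.log_nonneg hM
  have hlL := Real.log_nonneg hL
  have h0 : 0 ≤ L⁻¹ * y⁻¹ := by positivity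
  rcases hy.eq_or_lt with rfl | hy
  · simp only [Real.log_zero, abs_zero]; linarith
  rcases le_total 1 y with h1 | h1
  · rw [abs_of_nonneg (Real.log_nonneg h1)]
    linarith [Real.log_le_log hy hyM]
  · rw [abs_of_nonpos (Real.log_nonpos hy.le h1)]
    have : Real.log (L⁻¹ * y⁻¹) ≤ L⁻¹ * y⁻¹ := by
      have := Real.log_le_sub_one_of_pos (x := L⁻¹ * y⁻¹) (by positivity)
      linarith
    rw [Real.log_mul (by positivity) (by positivity), Real.log_inv, Real.log_inv] at this
    linarith

theorem integrableOn_log_norm_sub (a : ℂ) {s : Set ℂ} (hs : Bornology.IsBounded s)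
    (hsm : MeasurableSet s) : IntegrableOn (fun x : ℂ => Real.log ‖x - a‖) s := by
  obtain ⟨R, hR⟩ := hs.exists_norm_le
  have hfin : volume s ≠ ⊤ := hs.measure_lt_top.ne
  refine Integrable.mono' ((integrableOn_const hfin (C := Real.log (max 1 (R + ‖a‖)))).add
    (integrableOn_inv_norm_sub a hfin)) ?_ ?_
  · exact (Real.measurable_log.comp (by fun_prop)).aestronglyMeasurable
  · refine (ae_restrict_iff' hsm).2 (ae_of_all _ fun x hx => ?_)
    have h1 : ‖x - a‖ ≤ max 1 (R + ‖a‖) :=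
      (norm_sub_le _ _).trans ((add_le_add_left (hR x hx) _).trans (le_max_right _ _))
    have := abs_log_le (norm_nonneg (x - a)) h1 (le_max_left _ _) le_rfl
    simpa using this

theorem setIntegral_abs_log_norm_sub_le (a : ℂ) {s : Set ℂ} (hs : Bornology.IsBounded s)
    (hsm : MeasurableSet s) {M L : ℝ} (hM : 1 ≤ M) (hL : 1 ≤ L) (hsM : ∀ x ∈ s, ‖x - a‖ ≤ M) :
    ∫ x in s, |Real.log ‖x - a‖| ≤
      (Real.log M + Real.log L) * volume.real s + L⁻¹ * (discInvNormIntegral + volume.real s) := by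
  have hfin : volume s ≠ ⊤ := hs.measure_lt_top.ne
  calc ∫ x in s, |Real.log ‖x - a‖|
      ≤ ∫ x in s, ((Real.log M + Real.log L) + L⁻¹ * ‖x - a‖⁻¹) :=
        setIntegral_mono_on (integrableOn_log_norm_sub a hs hsm).abs
          ((integrableOn_const hfin).add ((integrableOn_inv_norm_sub a hfin).const_mul _)) hsm
          fun x hx => abs_log_le (norm_nonneg _) (hsM x hx) hM hL
    _ = (Real.log M + Real.log L) * volume.real s + L⁻¹ * ∫ x in s, ‖x - a‖⁻¹ := by
        have hc : Integrable (fun _ : ℂ => Real.log M + Real.log L) (volume.restrict s) :=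
          integrableOn_const hfin
        rw [integral_add hc ((integrableOn_inv_norm_sub a hfin).const_mul _), integral_const_mul]
        simp [mul_comm]
    _ ≤ _ := by
        gcongr
        exact setIntegral_inv_norm_sub_le a hfin

/-! ### Annular averages of the logarithmic kernel -/

/-- The open annulus centred at the origin. -/
def annulus (s t : ℝ) : Set ℂ := {x | s < ‖x‖ ∧ ‖x‖ < t}

theorem measurableSet_annulus (s t : ℝ) : MeasurableSet (annulus s t) :=
  (measurableSet_lt measurable_const measurable_norm).inter
    (measurableSet_lt measurable_norm measurable_const)

theorem isBounded_annulus (s t : ℝ) : Bornology.IsBounded (annulus s t) :=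
  Metric.isBounded_ball.subset fun x hx => (by simpa using hx.2 : x ∈ Metric.ball (0 : ℂ) t)

theorem setIntegral_annulus_rotate (f : ℂ → ℝ) (s t θ : ℝ) :
    ∫ x in annulus s t, f (Complex.exp (θ * Complex.I) * x) = ∫ x in annulus s t, f x := by
  have hpre : annulus s t = (rotation (Circle.exp θ)) ⁻¹' (annulus s t) := by
    ext x; simp [annulus]
  have := (rotation (Circle.exp θ)).measurePreserving.setIntegral_preimage_emb
    (rotation (Circle.exp θ)).toHomeomorph.measurableEmbedding f (annulus s t)
  rw [← hpre] at this
  rw [← this]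
  simp [rotation_apply]

theorem integrable_annulus_rotate {f : ℂ → ℝ} {s t : ℝ} (hf : IntegrableOn f (annulus s t))
    (θ : ℝ) : IntegrableOn (fun x => f (Complex.exp (θ * Complex.I) * x)) (annulus s t) := by
  have hpre : annulus s t = (rotation (Circle.exp θ)) ⁻¹' (annulus s t) := by
    ext x; simp [annulus]
  have := ((rotation (Circle.exp θ)).measurePreserving.integrableOn_comp_preimage
    (rotation (Circle.exp θ)).toHomeomorph.measurableEmbedding (f := f) (s := annulus s t)).2 hf
  rw [← hpre] at this
  refine this.congr (ae_of_all _ fun x => ?_)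
  simp [rotation_apply]

/-- Jensen's formula: dividing by `x` reduces to the mean of `log ‖· - b / x‖` over the unit circle,
which is the positive part of `log ‖b / x‖`. -/
theorem integral_log_norm_rotate_sub {x : ℂ} (hx : x ≠ 0) (b : ℂ) :
    ∫ θ in Set.Ioc 0 (2 * Real.pi), Real.log ‖Complex.exp (θ * Complex.I) * x - b‖ =
      2 * Real.pi * Real.log (max ‖x‖ ‖b‖) := by
  have h1 := circleAverage_log_norm_sub_const_eq_posLog (a := b / x)
  rw [Real.circleAverage_def, smul_eq_mul, inv_mul_eq_iff_eq_mul₀ (by positivity),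
    intervalIntegral.integral_of_le (by positivity)] at h1
  have hint : IntegrableOn (fun θ : ℝ => Real.log ‖circleMap 0 1 θ - b / x‖)
      (Set.Ioc 0 (2 * Real.pi)) := by
    have := circleIntegrable_log_norm_sub_const (a := b / x) (c := 0) 1
    exact (intervalIntegrable_iff_integrableOn_Ioc_of_le (by positivity)).1 this
  have hx' : 0 < ‖x‖ := norm_pos_iff.2 hx
  have key : ∀ᵐ θ : ℝ ∂(volume.restrict (Set.Ioc 0 (2 * Real.pi))),
      Real.log ‖Complex.exp (θ * Complex.I) * x - b‖
        = Real.log ‖x‖ + Real.log ‖circleMap 0 1 θ - b / x‖ := by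
    have hcount : ((circleMap 0 1) ⁻¹' {b / x}).Countable :=
      Set.Countable.preimage_circleMap (Set.countable_singleton _) 0 one_ne_zero
    -- Since `Real.log 0 = 0`, the product rule fails at the angles where the circle meets `b / x`;
    -- these are countable.
    filter_upwards [ae_restrict_of_ae (hcount.ae_notMem volume)] with θ hθ
    have hne : circleMap 0 1 θ - b / x ≠ 0 := sub_ne_zero.2 hθ
    rw [← Real.log_mul hx'.ne' (norm_ne_zero_iff.2 hne), ← norm_mul]
    congr 2
    simp only [circleMap, Complex.ofReal_one, one_mul, zero_add]
    field_simp
  rw [integral_congr_ae key, integral_add (integrable_const _) hint, h1]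
  have : Real.log (max ‖x‖ ‖b‖) = Real.log ‖x‖ + Real.posLog ‖b / x‖ := by
    rw [Real.posLog_eq_log_max_one (norm_nonneg _), ← Real.log_mul hx'.ne' (by positivity),
      mul_max_of_nonneg _ _ hx'.le, norm_div]
    congr 2
    · ring
    · field_simp
  rw [this]
  simp [Real.pi_nonneg]
  ring

/-- The logarithmic potential of the uniform measure on an annulus is radial. -/
theorem setIntegral_annulus_log_norm_sub {s : ℝ} (hs : 0 ≤ s) (t : ℝ) (b : ℂ) :
    ∫ x in annulus s t, Real.log ‖x - b‖ = ∫ x in annulus s t, Real.log (max ‖x‖ ‖b‖) := by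
  have hlog := integrableOn_log_norm_sub b (isBounded_annulus s t) (measurableSet_annulus s t)
  have hmeas : Measurable fun p : ℝ × ℂ =>
      Real.log ‖Complex.exp (p.1 * Complex.I) * p.2 - b‖ :=
    Real.measurable_log.comp (by fun_prop)
  -- Integrability on the product justifies averaging over all rotations, which leave the annulus
  -- invariant, and swapping the two integrals.
  have hprod : Integrable (fun p : ℝ × ℂ => Real.log ‖Complex.exp (p.1 * Complex.I) * p.2 - b‖)
      ((volume.restrict (Set.Ioc 0 (2 * Real.pi))).prod (volume.restrict (annulus s t))) := by
    rw [integrable_prod_iff hmeas.aestronglyMeasurable]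
    refine ⟨ae_of_all _ fun θ => integrable_annulus_rotate hlog θ, ?_⟩
    have : ∀ θ : ℝ, ∫ x in annulus s t, ‖Real.log ‖Complex.exp (θ * Complex.I) * x - b‖‖
        = ∫ x in annulus s t, ‖Real.log ‖x - b‖‖ := fun θ =>
      setIntegral_annulus_rotate (fun x => ‖Real.log ‖x - b‖‖) s t θ
    simp only [this]
    exact integrable_const _
  have hswap := integral_integral_swap
    (f := fun (θ : ℝ) (x : ℂ) => Real.log ‖Complex.exp (θ * Complex.I) * x - b‖) hprod
  have hL : ∀ θ : ℝ, ∫ x in annulus s t, Real.log ‖Complex.exp (θ * Complex.I) * x - b‖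
      = ∫ x in annulus s t, Real.log ‖x - b‖ := fun θ =>
    setIntegral_annulus_rotate (fun x => Real.log ‖x - b‖) s t θ
  simp only [hL] at hswap
  have hR : ∫ x in annulus s t, ∫ θ in Set.Ioc 0 (2 * Real.pi),
        Real.log ‖Complex.exp (θ * Complex.I) * x - b‖
      = ∫ x in annulus s t, 2 * Real.pi * Real.log (max ‖x‖ ‖b‖) :=
    setIntegral_congr_fun (measurableSet_annulus s t) fun x hx =>
      integral_log_norm_rotate_sub (norm_pos_iff.1 (hs.trans_lt hx.1)) b
  rw [hR, integral_const_mul] at hswap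
  have h2 : ∫ _ in Set.Ioc 0 (2 * Real.pi), (∫ x in annulus s t, Real.log ‖x - b‖)
      = 2 * Real.pi * ∫ x in annulus s t, Real.log ‖x - b‖ := by
    simp [Real.pi_nonneg]
  rw [h2] at hswap
  exact mul_left_cancel₀ (by positivity) hswap

/-- The difference of the averages of `log ‖· - a‖` over two concentric homothetic annuli, as a
function of `a`. -/
noncomputable def annularPotential (s t r : ℝ) (c a : ℂ) : ℝ :=
  ∫ x in annulus s t, (Real.log ‖r * x + c - a‖ - Real.log ‖x + c - a‖)

theorem integrableOn_log_norm_dilate_sub (s t : ℝ) {r : ℝ} (hr : 0 < r) (b : ℂ) :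
    IntegrableOn (fun x : ℂ => Real.log ‖r * x - b‖) (annulus s t) ∧
    ∀ᵐ x : ℂ, Real.log ‖r * x - b‖ = Real.log r + Real.log ‖x - b / r‖ := by
  have hae : ∀ᵐ x : ℂ, Real.log ‖r * x - b‖ = Real.log r + Real.log ‖x - b / r‖ := by
    filter_upwards [(Set.countable_singleton (b / r : ℂ)).ae_notMem volume] with x hx
    have hne : x - b / r ≠ 0 := sub_ne_zero.2 hx
    rw [← Real.log_mul hr.ne' (norm_ne_zero_iff.2 hne)]
    have : (r * x - b : ℂ) = r * (x - b / r) := by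
      have : (r : ℂ) ≠ 0 := by exact_mod_cast hr.ne'
      field_simp
    rw [this, norm_mul, Complex.norm_real, Real.norm_of_nonneg hr.le]
  refine ⟨?_, hae⟩
  have hc : IntegrableOn (fun _ : ℂ => Real.log r) (annulus s t) :=
    integrableOn_const (isBounded_annulus s t).measure_lt_top.ne
  exact (hc.add (integrableOn_log_norm_sub (b / r) (isBounded_annulus s t)
    (measurableSet_annulus s t))).congr
    ((ae_restrict_of_ae hae).mono fun x hx => hx.symm)

/-- Radial symmetry replaces the singular kernel by `log (max · ·)`, after which the two annuli can
be compared pointwise in `x`. -/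
theorem annularPotential_eq {s : ℝ} (hs : 0 ≤ s) (t : ℝ) {r : ℝ} (hr : 0 < r) (c a : ℂ) :
    annularPotential s t r c a = ∫ x in annulus s t,
      (Real.log (max (r * ‖x‖) ‖a - c‖) - Real.log (max ‖x‖ ‖a - c‖)) := by
  set b := a - c with hb
  have e1 : ∀ x : ℂ, r * x + c - a = r * x - b := fun x => by rw [hb]; ring
  have e2 : ∀ x : ℂ, x + c - a = x - b := fun x => by rw [hb]; ring
  obtain ⟨hi1, hae⟩ := integrableOn_log_norm_dilate_sub s t hr b
  have hi2 := integrableOn_log_norm_sub b (isBounded_annulus s t) (measurableSet_annulus s t)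
  have hi3 := integrableOn_log_norm_sub (b / r) (isBounded_annulus s t)
    (measurableSet_annulus s t)
  have hfin : volume (annulus s t) ≠ ⊤ := (isBounded_annulus s t).measure_lt_top.ne
  have hc : Integrable (fun _ : ℂ => Real.log r) (volume.restrict (annulus s t)) :=
    integrableOn_const hfin
  have hmaxint : ∀ q : ℝ, 0 < q → ∀ v : ℝ, 0 ≤ v →
      IntegrableOn (fun x : ℂ => Real.log (max (q * ‖x‖) v)) (annulus s t) := by
    intro q hq v hv
    have hmeas : Measurable fun x : ℂ => Real.log (max (q * ‖x‖) v) :=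
      Real.measurable_log.comp (by fun_prop)
    have hi0 := (integrableOn_log_norm_dilate_sub s t hq 0).1
    -- The maximum is one of its two arguments, so the absolute value of its logarithm is at most
    -- the sum of theirs.
    refine Integrable.mono' (hi0.abs.add (integrableOn_const hfin (C := |Real.log v|)))
      hmeas.aestronglyMeasurable (ae_of_all _ fun x => ?_)
    have hn : ‖(q : ℂ) * x - 0‖ = q * ‖x‖ := by
      rw [sub_zero, norm_mul, Complex.norm_real, Real.norm_of_nonneg hq.le]
    simp only [Pi.add_apply, hn, Real.norm_eq_abs]
    rcases max_choice (q * ‖x‖) v with h | h <;> rw [h]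
    · linarith [abs_nonneg (Real.log v)]
    · linarith [abs_nonneg (Real.log (q * ‖x‖))]
  unfold annularPotential
  simp only [e1, e2]
  rw [integral_sub hi1 hi2, integral_congr_ae (ae_restrict_of_ae hae), integral_add hc hi3,
    setIntegral_annulus_log_norm_sub hs t (b / r), setIntegral_annulus_log_norm_sub hs t b]
  have i1 : Integrable (fun x : ℂ => Real.log (max (r * ‖x‖) ‖b‖))
      (volume.restrict (annulus s t)) := hmaxint r hr ‖b‖ (norm_nonneg _)
  have i2 : Integrable (fun x : ℂ => Real.log (max ‖x‖ ‖b‖))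
      (volume.restrict (annulus s t)) := by
    have := hmaxint 1 one_pos ‖b‖ (norm_nonneg _)
    simp only [one_mul] at this
    exact this
  have i3 : Integrable (fun x : ℂ => Real.log (max ‖x‖ ‖b / r‖))
      (volume.restrict (annulus s t)) := by
    have := hmaxint 1 one_pos ‖b / r‖ (norm_nonneg _)
    simp only [one_mul] at this
    exact this
  rw [integral_sub i1 i2, ← integral_add hc i3]
  congr 1
  refine setIntegral_congr_fun (measurableSet_annulus s t) fun x hx => ?_
  have hx0 : 0 < ‖x‖ := hs.trans_lt hx.1
  rw [← Real.log_mul hr.ne' (by positivity), mul_max_of_nonneg _ _ hr.le, norm_div,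
    Complex.norm_real, Real.norm_of_nonneg hr.le, mul_div_cancel₀ _ hr.ne']

theorem log_max_mul_sub_log_max_mem {r x v : ℝ} (hr : 1 ≤ r) (hx : 0 < x) :
    0 ≤ Real.log (max (r * x) v) - Real.log (max x v) ∧
      Real.log (max (r * x) v) - Real.log (max x v) ≤ Real.log r := by
  have hm : 0 < max x v := lt_max_of_lt_left hx
  constructor
  · rw [sub_nonneg]
    exact Real.log_le_log hm (max_le_max_right _ (by nlinarith))
  · rw [sub_le_iff_le_add, ← Real.log_mul (by positivity) hm.ne']
    refine Real.log_le_log (lt_max_of_lt_left (by positivity)) (max_le ?_ ?_)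
    · gcongr; exact le_max_left _ _
    · nlinarith [le_max_right x v]

/-- Bounds for the annular potential: it lies between multiples of the indicator functions of
two balls. -/
theorem annularPotential_bounds {s t r : ℝ} (hs : 0 ≤ s) (hr : 1 ≤ r) (c a : ℂ) :
    (Metric.ball c s).indicator (fun _ => volume.real (annulus s t) * Real.log r) a
        ≤ annularPotential s t r c a ∧
      annularPotential s t r c a
        ≤ (Metric.ball c (r * t)).indicator
            (fun _ => volume.real (annulus s t) * Real.log r) a := by
  have hr0 : 0 < r := one_pos.trans_le hr
  have hfin : volume (annulus s t) ≠ ⊤ := (isBounded_annulus s t).measure_lt_top.ne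
  rw [annularPotential_eq hs t hr0]
  have hmem : ∀ x ∈ annulus s t, 0 < ‖x‖ := fun x hx => hs.trans_lt hx.1
  have hmeas : Measurable fun x : ℂ =>
      Real.log (max (r * ‖x‖) ‖a - c‖) - Real.log (max ‖x‖ ‖a - c‖) :=
    (Real.measurable_log.comp (by fun_prop)).sub (Real.measurable_log.comp (by fun_prop))
  have hconst : IntegrableOn (fun _ : ℂ => Real.log r) (annulus s t) := integrableOn_const hfin
  have hint : IntegrableOn (fun x : ℂ =>
      Real.log (max (r * ‖x‖) ‖a - c‖) - Real.log (max ‖x‖ ‖a - c‖)) (annulus s t) := by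
    refine Integrable.mono' hconst hmeas.aestronglyMeasurable
      ((ae_restrict_iff' (measurableSet_annulus s t)).2 (ae_of_all _ fun x hx => ?_))
    have := log_max_mul_sub_log_max_mem (v := ‖a - c‖) hr (hmem x hx)
    rw [Real.norm_of_nonneg this.1]
    exact this.2
  have hK : ∫ _ in annulus s t, Real.log r = volume.real (annulus s t) * Real.log r := by simp
  constructor
  · by_cases h : a ∈ Metric.ball c s
    · rw [Set.indicator_of_mem h, ← hK]
      -- For `a` inside the inner circle both maxima are attained by the terms in `‖x‖`, and the
      -- integrand is exactly `log r`. Outside radius `r * t`, treated below, both equal `‖a - c‖`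
      -- and the difference vanishes.
      refine setIntegral_mono_on hconst hint (measurableSet_annulus s t) fun x hx => ?_
      have h1 : ‖a - c‖ ≤ ‖x‖ := by
        rw [Metric.mem_ball, dist_eq_norm] at h
        exact h.le.trans hx.1.le
      rw [max_eq_left h1, max_eq_left (h1.trans (by nlinarith [hmem x hx])),
        Real.log_mul hr0.ne' (hmem x hx).ne']
      linarith
    · rw [Set.indicator_of_notMem h]
      exact setIntegral_nonneg (measurableSet_annulus s t) fun x hx =>
        (log_max_mul_sub_log_max_mem hr (hmem x hx)).1
  · by_cases h : a ∈ Metric.ball c (r * t)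
    · rw [Set.indicator_of_mem h, ← hK]
      exact setIntegral_mono_on hint hconst (measurableSet_annulus s t) fun x hx =>
        (log_max_mul_sub_log_max_mem hr (hmem x hx)).2
    · rw [Set.indicator_of_notMem h]
      refine (setIntegral_eq_zero_of_forall_eq_zero fun x hx => ?_).le
      have h1 : r * ‖x‖ ≤ ‖a - c‖ := by
        rw [Metric.mem_ball, dist_eq_norm, not_lt] at h
        exact (mul_le_mul_of_nonneg_left hx.2.le hr0.le).trans h
      rw [max_eq_right h1, max_eq_right (le_trans (by nlinarith [hmem x hx]) h1), sub_self]

/-! ### From potentials to numbers of points in balls -/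

/-- The difference `log ∏ ‖x - w k‖ - log ∏ ‖x - z k‖` of two logarithmic potentials. -/
noncomputable def logPotentialSub {d e : ℕ} (w : Fin e → ℂ) (z : Fin d → ℂ) (x : ℂ) : ℝ :=
  ∑ k, Real.log ‖x - w k‖ - ∑ k, Real.log ‖x - z k‖

theorem integrableOn_logPotentialSub {d e : ℕ} (w : Fin e → ℂ) (z : Fin d → ℂ) {s : Set ℂ}
    (hs : Bornology.IsBounded s) (hsm : MeasurableSet s) :
    IntegrableOn (logPotentialSub w z) s :=
  Integrable.sub (integrable_finsetSum _ fun _ _ => integrableOn_log_norm_sub _ hs hsm)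
    (integrable_finsetSum _ fun _ _ => integrableOn_log_norm_sub _ hs hsm)

/-- The dilated and translated annulus stays in the disc of radius `N`, and the change of variables
has Jacobian factor `r⁻² ≤ 1`. -/
theorem setIntegral_annulus_abs_dilate_le {U : ℂ → ℝ} {N s t r : ℝ} {c : ℂ} (hr : 1 ≤ r)
    (hN : ‖c‖ + r * t ≤ N) (hU : IntegrableOn U (Metric.closedBall 0 N)) :
    |∫ x in annulus s t, U (r * x + c)| ≤ ∫ x in Metric.closedBall 0 N, |U x| := by
  have hr0 : 0 < r := one_pos.trans_le hr
  set G : ℂ → ℝ := (Metric.closedBall 0 N).indicator fun x => |U x| with hG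
  have hGint : Integrable G := (integrable_indicator_iff measurableSet_closedBall).2 hU.abs
  have hGnn : ∀ x, 0 ≤ G x := fun x => Set.indicator_nonneg (fun _ _ => abs_nonneg _) _
  have hcomp : Integrable fun x : ℂ => G (r • x + c) :=
    (hGint.comp_add_right c).comp_smul hr0.ne'
  calc |∫ x in annulus s t, U (r * x + c)|
      ≤ ∫ x in annulus s t, |U (r * x + c)| := abs_integral_le_integral_abs
    _ = ∫ x in annulus s t, G (r • x + c) := by
        refine setIntegral_congr_fun (measurableSet_annulus s t) fun x hx => ?_
        simp only [hG, Complex.real_smul]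
        rw [Set.indicator_of_mem]
        rw [mem_closedBall_zero_iff]
        refine (norm_add_le _ _).trans ?_
        rw [norm_mul, Complex.norm_real, Real.norm_of_nonneg hr0.le]
        nlinarith [hx.2]
    _ ≤ ∫ x, G (r • x + c) := setIntegral_le_integral hcomp (ae_of_all _ fun x => hGnn _)
    _ = |(r ^ Module.finrank ℝ ℂ)⁻¹| • ∫ x, G x := by
        rw [Measure.integral_comp_smul volume (fun x => G (x + c)) r, integral_add_right_eq_self]
    _ ≤ ∫ x, G x := by
        rw [smul_eq_mul]
        refine mul_le_of_le_one_left (integral_nonneg hGnn) ?_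
        rw [abs_of_nonneg (by positivity)]
        exact inv_le_one_of_one_le₀ (one_le_pow₀ hr)
    _ = ∫ x in Metric.closedBall 0 N, |U x| := integral_indicator measurableSet_closedBall

theorem volume_annulus_pos {s t : ℝ} (hs : 0 ≤ s) (hst : s < t) :
    0 < volume.real (annulus s t) := by
  refine ENNReal.toReal_pos ?_ (isBounded_annulus s t).measure_lt_top.ne
  have ho : IsOpen (annulus s t) :=
    (isOpen_lt continuous_const continuous_norm).inter (isOpen_lt continuous_norm continuous_const)
  refine (ho.measure_pos volume ⟨(((s + t) / 2 : ℝ) : ℂ), ?_⟩).ne'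
  simp only [annulus, Set.mem_ofPred_eq, Complex.norm_real]
  rw [Real.norm_of_nonneg (by linarith)]
  constructor <;> linarith

/-- If the logarithmic potentials of two finite families are close in `L¹`, then a ball contains
almost as many points of the first family as a smaller ball does of the second family. -/
theorem exists_mul_sum_indicator_ball_le {s r : ℝ} (hs : 0 < s) (hsr : s < r) :
    ∃ K : ℝ, 0 < K ∧ ∀ (c : ℂ) (N : ℝ), ‖c‖ + r ≤ N → ∀ (d e : ℕ) (w : Fin e → ℂ) (z : Fin d → ℂ),
      K * ∑ k, (Metric.ball c s).indicator (fun _ => (1 : ℝ)) (z k) ≤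
        K * ∑ k, (Metric.ball c r).indicator (fun _ => (1 : ℝ)) (w k) +
          2 * ∫ x in Metric.closedBall 0 N, |logPotentialSub w z x| := by
  -- The outer radius `t` lies strictly between `s` and `r`, and the ratio `q = r / t` dilates it
  -- exactly to `r`.
  set t := (s + r) / 2 with ht
  have hst : s < t := by rw [ht]; linarith
  have htr : t < r := by rw [ht]; linarith
  have ht0 : 0 < t := hs.trans hst
  set q := r / t with hq
  have hq1 : 1 < q := (one_lt_div ht0).2 htr
  have hqt : q * t = r := div_mul_cancel₀ _ ht0.ne'
  refine ⟨volume.real (annulus s t) * Real.log q,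
    mul_pos (volume_annulus_pos hs.le hst) (Real.log_pos hq1), fun c N hN d e w z => ?_⟩
  set K := volume.real (annulus s t) * Real.log q with hK
  have hb := fun a => annularPotential_bounds (t := t) hs.le hq1.le c a
  rw [hqt, ← hK] at hb
  have hU : IntegrableOn (logPotentialSub w z) (Metric.closedBall 0 N) :=
    integrableOn_logPotentialSub w z Metric.isBounded_closedBall measurableSet_closedBall
  have hcount : ∀ (m : ℕ) (y : Fin m → ℂ) (v : ℝ),
      ∑ k, (Metric.ball c v).indicator (fun _ => K) (y k)
        = K * ∑ k, (Metric.ball c v).indicator (fun _ => (1 : ℝ)) (y k) := by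
    intro m y v
    rw [Finset.mul_sum]
    refine Finset.sum_congr rfl fun k _ => ?_
    by_cases h : y k ∈ Metric.ball c v <;> simp [h]
  have hz := Finset.sum_le_sum fun k (_ : k ∈ Finset.univ) => (hb (z k)).1
  have hw := Finset.sum_le_sum fun k (_ : k ∈ Finset.univ) => (hb (w k)).2
  rw [hcount] at hz hw
  have hI : ∀ a : ℂ, IntegrableOn (fun x : ℂ =>
      Real.log ‖q * x + c - a‖ - Real.log ‖x + c - a‖) (annulus s t) := by
    intro a
    have e1 : ∀ x : ℂ, q * x + c - a = q * x - (a - c) := fun x => by ring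
    have e2 : ∀ x : ℂ, x + c - a = x - (a - c) := fun x => by ring
    simp only [e1, e2]
    exact (integrableOn_log_norm_dilate_sub s t (by positivity) _).1.sub
      (integrableOn_log_norm_sub _ (isBounded_annulus s t) (measurableSet_annulus s t))
  have hUq : ∀ p : ℝ, 1 ≤ p → IntegrableOn (fun x : ℂ => logPotentialSub w z (p * x + c))
      (annulus s t) := by
    intro p hp
    have e1 : ∀ x a : ℂ, p * x + c - a = p * x - (a - c) := fun x a => by ring
    simp only [logPotentialSub, e1]
    have h0 := fun a => (integrableOn_log_norm_dilate_sub s t (one_pos.trans_le hp) a).1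
    exact Integrable.sub (integrable_finsetSum _ fun _ _ => h0 _)
      (integrable_finsetSum _ fun _ _ => h0 _)
  -- The undilated average is written with ratio `1`, so the same `L¹` estimate bounds both terms;
  -- this is the source of the factor `2`.
  have hdiff : ∑ k, annularPotential s t q c (w k) - ∑ k, annularPotential s t q c (z k)
      = (∫ x in annulus s t, logPotentialSub w z (q * x + c))
        - ∫ x in annulus s t, logPotentialSub w z ((1 : ℝ) * x + c) := by
    simp only [annularPotential]
    rw [← integral_finsetSum _ fun k _ => hI (w k), ← integral_finsetSum _ fun k _ => hI (z k),
      ← integral_sub (integrable_finsetSum _ fun k _ => hI (w k))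
        (integrable_finsetSum _ fun k _ => hI (z k)), ← integral_sub (hUq q hq1.le) (hUq 1 le_rfl)]
    refine integral_congr_ae (ae_of_all _ fun x => ?_)
    simp only [logPotentialSub, Finset.sum_sub_distrib, Complex.ofReal_one, one_mul]
    ring
  have h1 := setIntegral_annulus_abs_dilate_le (s := s) (t := t) (c := c) hq1.le
    (by rw [hqt]; exact hN) hU
  have h2 := setIntegral_annulus_abs_dilate_le (s := s) (t := t) (c := c) le_rfl
    (by rw [one_mul]; linarith) hU
  linarith [abs_le.1 h1, abs_le.1 h2]

/-! ### Telescoping along the rows -/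

/-- A triangle of points in which every row enumerates the zeros of the randomized derivative
built from the row above, with positive weights, for the first `M` steps. -/
structure IsDerivativeTriangle {n : ℕ} (M : ℕ) (Z : (j : ℕ) → Fin (n - j) → ℂ)
    (g : (j : ℕ) → Fin (n - j) → ℝ) : Prop where
  lt : M < n
  pos : ∀ j < M, ∀ k, 0 < g j k
  zeros : ∀ j < M, EnumeratesZeros (Z (j + 1)) (randomizedDerivative (Z j) (g j))

namespace IsDerivativeTriangle

variable {n M : ℕ} {Z : (j : ℕ) → Fin (n - j) → ℂ} {g : (j : ℕ) → Fin (n - j) → ℝ}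

theorem norm_le (h : IsDerivativeTriangle M Z g) {R : ℝ} (h0 : ∀ k, ‖Z 0 k‖ ≤ R) {j : ℕ}
    (hj : j ≤ M) (k : Fin (n - j)) : ‖Z j k‖ ≤ R := by
  induction j with
  | zero => exact h0 k
  | succ j ih =>
    have := h.lt
    exact (h.zeros j hj).norm_le (by omega) (h.pos j hj) (ih (by omega)) k

theorem sum_pos (h : IsDerivativeTriangle M Z g) {j : ℕ} (hj : j < M) : 0 < ∑ k, g j k :=
  Finset.sum_pos (fun k _ => h.pos j hj k)
    ⟨⟨0, by have := h.lt; omega⟩, Finset.mem_univ _⟩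

/-- The logarithm of `EnumeratesZeros.prod_eq` is the increment of one step. Nonvanishing of the
Cauchy sums ensures that `x` is not a zero in the next row, so that the logarithms of products
split. -/
theorem logPotentialSub_eq (h : IsDerivativeTriangle M Z g) {x : ℂ}
    (hx : ∀ j < M, ∀ k, x ≠ Z j k) (hS : ∀ j < M, cauchySum (Z j) (g j) x ≠ 0) {i : ℕ}
    (hi : i ≤ M) : logPotentialSub (Z i) (Z 0) x =
      ∑ j ∈ Finset.range i, Real.log (‖cauchySum (Z j) (g j) x‖ / ∑ k, g j k) := by
  induction i with
  | zero => simp [logPotentialSub]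
  | succ i ih =>
    have hiM : i < M := hi
    rw [Finset.sum_range_succ, ← ih hiM.le]
    have hlt := h.lt
    have hprod := (h.zeros i hiM).prod_eq (by omega) (hx i hiM)
    have hG := h.sum_pos hiM
    have hne : ∀ k, x - Z i k ≠ 0 := fun k => sub_ne_zero.2 (hx i hiM k)
    have hPne : (∏ k, (x - Z i k)) * cauchySum (Z i) (g i) x ≠ 0 :=
      mul_ne_zero (Finset.prod_ne_zero_iff.2 fun k _ => hne k) (hS i hiM)
    have hne' : ∀ k, x - Z (i + 1) k ≠ 0 := by
      rw [← hprod] at hPne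
      exact fun k => Finset.prod_ne_zero_iff.1 (right_ne_zero_of_mul hPne) k (Finset.mem_univ k)
    have hlog := congrArg (fun y : ℂ => Real.log ‖y‖) hprod
    simp only [norm_mul, norm_prod, Complex.norm_real] at hlog
    rw [Real.norm_of_nonneg hG.le,
      Real.log_mul hG.ne' (Finset.prod_ne_zero_iff.2 fun k _ => norm_ne_zero_iff.2 (hne' k)),
      Real.log_mul (Finset.prod_ne_zero_iff.2 fun k _ => norm_ne_zero_iff.2 (hne k))
        (norm_ne_zero_iff.2 (hS i hiM)),
      Real.log_prod fun k _ => norm_ne_zero_iff.2 (hne' k),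
      Real.log_prod fun k _ => norm_ne_zero_iff.2 (hne k)] at hlog
    rw [Real.log_div (norm_ne_zero_iff.2 (hS i hiM)) hG.ne']
    simp only [logPotentialSub]
    linarith

/-- Every term is bounded on both sides: distance `δ` to the points gives `‖S‖ / G ≤ δ⁻¹`, while
`‖S‖ ≥ ε` and `G ≤ T` give `‖S‖ / G ≥ ε / T`. -/
theorem abs_logPotentialSub_le (h : IsDerivativeTriangle M Z g) {x : ℂ} {δ ε T Λ : ℝ}
    (hδ : 0 < δ) (hε : 0 < ε) (hx : ∀ j < M, ∀ k, δ ≤ ‖x - Z j k‖)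
    (hS : ∀ j < M, ε ≤ ‖cauchySum (Z j) (g j) x‖) (hT : ∀ j < M, ∑ k, g j k ≤ T)
    (hΛδ : -Real.log δ ≤ Λ) (hΛε : Real.log T - Real.log ε ≤ Λ) :
    |logPotentialSub (Z M) (Z 0) x| ≤ M * Λ := by
  rw [h.logPotentialSub_eq (fun j hj k hk => by
      have := hx j hj k
      rw [hk, sub_self, norm_zero] at this
      linarith) (fun j hj => norm_pos_iff.1 (hε.trans_le (hS j hj))) le_rfl]
  refine (Finset.abs_sum_le_sum_abs _ _).trans ?_
  refine (Finset.sum_le_card_nsmul _ _ Λ fun j hj => ?_).trans_eq (by simp)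
  have hjM := Finset.mem_range.1 hj
  have hG := h.sum_pos hjM
  have hSp := hε.trans_le (hS j hjM)
  rw [abs_le]
  constructor
  · rw [Real.log_div hSp.ne' hG.ne']
    have h1 := Real.log_le_log hε (hS j hjM)
    have h2 := Real.log_le_log hG (hT j hjM)
    linarith
  · have h1 := norm_cauchySum_le (h.pos j hjM) hδ (hx j hjM)
    have h2 : ‖cauchySum (Z j) (g j) x‖ / ∑ k, g j k ≤ δ⁻¹ := by
      rw [div_le_iff₀ hG, inv_mul_eq_div]
      exact h1
    have h3 := Real.log_le_log (by positivity) h2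
    rw [Real.log_inv] at h3
    linarith

end IsDerivativeTriangle

/-! ### Exceptional sets and the `L¹` estimate -/

theorem measurable_cauchySum_right {d : ℕ} (z : Fin d → ℂ) (g : Fin d → ℝ) :
    Measurable (cauchySum z g) :=
  measurable_cauchySum.comp (f := fun x : ℂ => (z, g, x)) (by fun_prop)

/-- The points of the disc of radius `N` at which some Cauchy sum of the first `M` rows is at
most `ε`. -/
def smallCauchySumSet {n : ℕ} (M : ℕ) (Z : (j : ℕ) → Fin (n - j) → ℂ)
    (g : (j : ℕ) → Fin (n - j) → ℝ) (N ε : ℝ) : Set ℂ :=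
  {x | x ∈ Metric.closedBall 0 N ∧ ∃ j < M, ‖cauchySum (Z j) (g j) x‖ ≤ ε}

theorem measurableSet_smallCauchySumSet {n : ℕ} (M : ℕ) (Z : (j : ℕ) → Fin (n - j) → ℂ)
    (g : (j : ℕ) → Fin (n - j) → ℝ) (N ε : ℝ) :
    MeasurableSet (smallCauchySumSet M Z g N ε) := by
  have : smallCauchySumSet M Z g N ε = Metric.closedBall 0 N ∩
      ⋃ j ∈ Finset.range M, {x | ‖cauchySum (Z j) (g j) x‖ ≤ ε} := by
    ext x; simp [smallCauchySumSet]
  rw [this]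
  exact measurableSet_closedBall.inter (Finset.measurableSet_biUnion _ fun j _ =>
    measurableSet_le (measurable_cauchySum_right _ _).norm measurable_const)

/-- The `δ`-neighbourhood of the points of the first `M` rows. -/
def nearPointsSet {n : ℕ} (M : ℕ) (Z : (j : ℕ) → Fin (n - j) → ℂ) (δ : ℝ) : Set ℂ :=
  ⋃ j ∈ Finset.range M, ⋃ k ∈ (Finset.univ : Finset (Fin (n - j))), Metric.ball (Z j k) δ

theorem measurableSet_nearPointsSet {n : ℕ} (M : ℕ) (Z : (j : ℕ) → Fin (n - j) → ℂ) (δ : ℝ) :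
    MeasurableSet (nearPointsSet M Z δ) :=
  Finset.measurableSet_biUnion _ fun _ _ => Finset.measurableSet_biUnion _ fun _ _ =>
    measurableSet_ball

theorem volume_nearPointsSet_le {n M : ℕ} (hM : M ≤ n) (Z : (j : ℕ) → Fin (n - j) → ℂ) {δ : ℝ}
    (hδ : 0 ≤ δ) : volume.real (nearPointsSet M Z δ) ≤ (n : ℝ) ^ 2 * (4 * δ ^ 2) := by
  have hball : ∀ a : ℂ, volume.real (Metric.ball a δ) ≤ 4 * δ ^ 2 := by
    intro a
    rw [Measure.real, Complex.volume_ball, ENNReal.toReal_mul, ENNReal.toReal_pow,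
      ENNReal.toReal_ofReal hδ]
    have : (ENNReal.toReal (NNReal.pi : ENNReal)) = Real.pi := rfl
    rw [this]
    nlinarith [Real.pi_le_four, sq_nonneg δ]
  have hrow : ∀ j ∈ Finset.range M, volume.real
      (⋃ k ∈ (Finset.univ : Finset (Fin (n - j))), Metric.ball (Z j k) δ) ≤ n * (4 * δ ^ 2) := by
    intro j _
    refine (measureReal_biUnion_finset_le _ _).trans ?_
    refine (Finset.sum_le_card_nsmul _ _ _ fun k _ => hball _).trans ?_
    rw [nsmul_eq_mul, Finset.card_univ, Fintype.card_fin]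
    gcongr
    exact Nat.sub_le _ _
  refine (measureReal_biUnion_finset_le _ _).trans ?_
  refine (Finset.sum_le_card_nsmul _ _ _ hrow).trans ?_
  rw [nsmul_eq_mul, Finset.card_range, sq (n : ℝ), mul_assoc]
  gcongr

/-- A crude bound without cancellation, meant for the exceptional set, where telescoping gives no
control. -/
theorem setIntegral_abs_logPotentialSub_le_of_subset {d e : ℕ} {w : Fin e → ℂ} {z : Fin d → ℂ}
    {R N L : ℝ} (hw : ∀ k, ‖w k‖ ≤ R) (hz : ∀ k, ‖z k‖ ≤ R) (hRN : 1 ≤ N + R) (hL : 1 ≤ L)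
    {s : Set ℂ} (hs : s ⊆ Metric.closedBall 0 N) (hsm : MeasurableSet s) :
    ∫ x in s, |logPotentialSub w z x| ≤
      (d + e) * ((Real.log (N + R) + Real.log L) * volume.real s
        + L⁻¹ * (discInvNormIntegral + volume.real s)) := by
  have hb : Bornology.IsBounded s := Metric.isBounded_closedBall.subset hs
  have hi := fun a => (integrableOn_log_norm_sub a hb hsm).abs
  have hone : ∀ a : ℂ, ‖a‖ ≤ R → ∫ x in s, |Real.log ‖x - a‖| ≤
      (Real.log (N + R) + Real.log L) * volume.real s
        + L⁻¹ * (discInvNormIntegral + volume.real s) := fun a ha =>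
    setIntegral_abs_log_norm_sub_le a hb hsm hRN hL fun x hx =>
      (norm_sub_le _ _).trans (add_le_add (mem_closedBall_zero_iff.1 (hs hx)) ha)
  calc ∫ x in s, |logPotentialSub w z x|
      ≤ ∫ x in s, (∑ k, |Real.log ‖x - w k‖| + ∑ k, |Real.log ‖x - z k‖|) := by
        refine integral_mono (integrableOn_logPotentialSub w z hb hsm).abs
          ((integrable_finsetSum _ fun k _ => hi (w k)).add
            (integrable_finsetSum _ fun k _ => hi (z k))) fun x => ?_
        simp only [logPotentialSub]
        exact (abs_sub _ _).trans
          (add_le_add (Finset.abs_sum_le_sum_abs _ _) (Finset.abs_sum_le_sum_abs _ _))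
    _ = (∑ k, ∫ x in s, |Real.log ‖x - w k‖|) + ∑ k, ∫ x in s, |Real.log ‖x - z k‖| := by
        rw [integral_add (integrable_finsetSum _ fun k _ => hi (w k))
            (integrable_finsetSum _ fun k _ => hi (z k)),
          integral_finsetSum _ fun k _ => hi (w k), integral_finsetSum _ fun k _ => hi (z k)]
    _ ≤ e • ((Real.log (N + R) + Real.log L) * volume.real s
          + L⁻¹ * (discInvNormIntegral + volume.real s)) +
        d • ((Real.log (N + R) + Real.log L) * volume.real s
          + L⁻¹ * (discInvNormIntegral + volume.real s)) := by
        refine add_le_add ?_ ?_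
        · exact (Finset.sum_le_card_nsmul _ _ _ fun k _ => hone _ (hw k)).trans_eq (by simp)
        · exact (Finset.sum_le_card_nsmul _ _ _ fun k _ => hone _ (hz k)).trans_eq (by simp)
    _ = _ := by simp only [nsmul_eq_mul]; ring

namespace IsDerivativeTriangle

variable {n M : ℕ} {Z : (j : ℕ) → Fin (n - j) → ℂ} {g : (j : ℕ) → Fin (n - j) → ℝ}

/-- `L¹` bound, on a disc, for the difference of the logarithmic potentials of the first and the
last row. -/
theorem setIntegral_abs_logPotentialSub_le (h : IsDerivativeTriangle M Z g) (hn : 2 ≤ n)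
    {A q : ℕ} (hA : 1 ≤ A) (h0 : ∀ k, ‖Z 0 k‖ ≤ (n : ℝ) ^ A)
    (hT : ∀ j < M, ∑ k, g j k ≤ (n : ℝ) ^ 4)
    (hV : volume.real (smallCauchySumSet M Z g n ((n : ℝ) ^ q)⁻¹) ≤ ((n : ℝ) ^ 2)⁻¹)
    {N : ℝ} (hN : N ≤ n) :
    ∫ x in Metric.closedBall 0 N, |logPotentialSub (Z M) (Z 0) x| ≤
      M * ((q + 4) * Real.log n) * volume.real (Metric.closedBall (0 : ℂ) N) +
      2 * n * ((A + 2) * Real.log n * (5 * ((n : ℝ) ^ 2)⁻¹) +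
        (n : ℝ)⁻¹ * (discInvNormIntegral + 5 * ((n : ℝ) ^ 2)⁻¹)) := by
  have hn1 : (1 : ℝ) ≤ n := by exact_mod_cast (by omega : 1 ≤ n)
  have hn2 : (2 : ℝ) ≤ n := by exact_mod_cast hn
  have hn0 : (0 : ℝ) < n := by linarith
  have hlogn : 0 ≤ Real.log n := Real.log_nonneg hn1
  -- At most `n ^ 2` discs of area at most `4 * δ ^ 2` then cover area at most `4 * n⁻²`; with the
  -- small-sum set this makes `5 * δ`.
  set δ : ℝ := ((n : ℝ) ^ 2)⁻¹ with hδ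
  set ε : ℝ := ((n : ℝ) ^ q)⁻¹ with hε
  have hδ0 : 0 < δ := by positivity
  have hε0 : 0 < ε := by positivity
  set D := Metric.closedBall (0 : ℂ) N with hD
  set U := logPotentialSub (Z M) (Z 0) with hU
  set B : Set ℂ := D ∩ (smallCauchySumSet M Z g n ε ∪ nearPointsSet M Z δ) with hB
  have hBm : MeasurableSet B := measurableSet_closedBall.inter
    ((measurableSet_smallCauchySumSet _ _ _ _ _).union (measurableSet_nearPointsSet _ _ _))
  have hBD : B ⊆ D := Set.inter_subset_left
  have hUi : IntegrableOn U D :=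
    integrableOn_logPotentialSub _ _ Metric.isBounded_closedBall measurableSet_closedBall
  have hUa : IntegrableOn (fun x => |U x|) D := hUi.abs
  have hDfin : volume D ≠ ⊤ := measure_closedBall_lt_top.ne
  have hsplit : ∫ x in D, |U x| = (∫ x in D \ B, |U x|) + ∫ x in B, |U x| := by
    rw [← setIntegral_union Set.disjoint_sdiff_left hBm (hUa.mono_set Set.sdiff_subset)
      (hUa.mono_set hBD), Set.sdiff_union_of_subset hBD]
  have hgood : ∫ x in D \ B, |U x| ≤ M * ((q + 4) * Real.log n) * volume.real D := by
    have hpt : ∀ x ∈ D \ B, |U x| ≤ M * ((q + 4) * Real.log n) := by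
      intro x hx
      have hxn : x ∈ Metric.closedBall (0 : ℂ) n := Metric.closedBall_subset_closedBall hN hx.1
      have hxB : x ∉ smallCauchySumSet M Z g n ε ∪ nearPointsSet M Z δ := fun h' => hx.2 ⟨hx.1, h'⟩
      rw [Set.mem_union, not_or] at hxB
      -- The two requirements on `Λ` are `2 * log n` from `δ`, and `(q + 4) * log n` from `T = n ^
      -- 4` and `ε = n ^ (-q)`; the larger serves for both.
      refine h.abs_logPotentialSub_le hδ0 hε0 (T := (n : ℝ) ^ 4) ?_ ?_ hT ?_ ?_
      · intro j hj k
        by_contra! hlt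
        refine hxB.2 ?_
        simp only [nearPointsSet, Set.mem_iUnion]
        exact ⟨j, Finset.mem_range.2 hj, k, Finset.mem_univ _, by
          rwa [Metric.mem_ball, dist_eq_norm]⟩
      · intro j hj
        by_contra! hlt
        exact hxB.1 ⟨hxn, j, hj, hlt.le⟩
      · rw [hδ, Real.log_inv, Real.log_pow]
        push_cast
        nlinarith [(Nat.cast_nonneg q : (0 : ℝ) ≤ q)]
      · rw [hε, Real.log_inv, Real.log_pow, Real.log_pow]
        push_cast
        linarith
    have hfin' : volume (D \ B) ≠ ⊤ := (measure_mono Set.sdiff_subset |>.trans_lt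
      measure_closedBall_lt_top).ne
    calc ∫ x in D \ B, |U x| ≤ ∫ _ in D \ B, M * ((q + 4) * Real.log n) :=
          setIntegral_mono_on (hUa.mono_set Set.sdiff_subset) (integrableOn_const hfin')
            (measurableSet_closedBall.diff hBm) hpt
      _ = M * ((q + 4) * Real.log n) * volume.real (D \ B) := by simp [mul_comm]
      _ ≤ _ := by
          refine mul_le_mul_of_nonneg_left ?_ (by positivity)
          exact measureReal_mono Set.sdiff_subset hDfin
  have hVB : volume.real B ≤ 5 * δ := by
    have h1 : volume.real B ≤
        volume.real (smallCauchySumSet M Z g n ε ∪ nearPointsSet M Z δ) := by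
      refine measureReal_mono Set.inter_subset_right ?_
      refine (measure_union_lt_top ?_ ?_).ne
      · exact (measure_mono fun x hx => hx.1).trans_lt
          (measure_closedBall_lt_top (x := (0 : ℂ)) (r := n))
      · refine (measure_biUnion_lt_top (Finset.finite_toSet _) fun j _ => ?_)
        exact measure_biUnion_lt_top (Finset.finite_toSet _) fun k _ => measure_ball_lt_top
    have h2 := volume_nearPointsSet_le h.lt.le Z hδ0.le
    have h3 : (n : ℝ) ^ 2 * (4 * δ ^ 2) = 4 * δ := by
      rw [hδ]; field_simp
    linarith [measureReal_union_le (μ := volume) (smallCauchySumSet M Z g n ε)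
      (nearPointsSet M Z δ)]
  have hbad : ∫ x in B, |U x| ≤ 2 * n * ((A + 2) * Real.log n * (5 * δ) +
        (n : ℝ)⁻¹ * (discInvNormIntegral + 5 * δ)) := by
    have hnA : (n : ℝ) ≤ (n : ℝ) ^ A := le_self_pow₀ hn1 (by omega)
    have hBn : B ⊆ Metric.closedBall 0 (n : ℝ) :=
      hBD.trans (Metric.closedBall_subset_closedBall hN)
    -- Applied with `R = n ^ A` and `L = n`: the factor `L⁻¹` absorbs the number of points, at the
    -- price of one more `log n`.
    refine (setIntegral_abs_logPotentialSub_le_of_subset (fun k => h.norm_le h0 le_rfl k) h0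
      (by linarith) hn1 hBn hBm).trans ?_
    have hlog : Real.log (n + (n : ℝ) ^ A) ≤ (A + 1) * Real.log n := by
      have : (n : ℝ) + (n : ℝ) ^ A ≤ (n : ℝ) ^ (A + 1) := by
        rw [pow_succ]; nlinarith
      have := Real.log_le_log (by positivity) this
      rw [Real.log_pow] at this
      push_cast at this
      exact this
    have hcard : ((n - 0 : ℕ) : ℝ) + ((n - M : ℕ) : ℝ) ≤ 2 * n := by
      have : ((n - 0 : ℕ) : ℝ) + ((n - M : ℕ) : ℝ) = ((n - 0 + (n - M) : ℕ) : ℝ) := by push_cast; rfl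
      rw [this]
      exact_mod_cast (by omega : n - 0 + (n - M) ≤ 2 * n)
    have hJ := discInvNormIntegral_nonneg
    have hlog0 : 0 ≤ Real.log (n + (n : ℝ) ^ A) := Real.log_nonneg (by linarith)
    gcongr
    linarith
  rw [hsplit]
  exact add_le_add hgood hbad

end IsDerivativeTriangle

/-- The `L¹` norms, on a fixed disc, of the differences of logarithmic potentials are `o(n)` when
the numbers of steps are `o(n / log n)`. -/
theorem tendsto_setIntegral_abs_logPotentialSub_div {m : ℕ → ℕ}
    (hm : Tendsto (fun n : ℕ => (m n : ℝ) / ((n : ℝ) / Real.log n)) atTop (𝓝 0))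
    {Z : (n j : ℕ) → Fin (n - j) → ℂ} {g : (n j : ℕ) → Fin (n - j) → ℝ} {A q : ℕ} (hA : 1 ≤ A)
    (h : ∀ᶠ n in atTop, IsDerivativeTriangle (m n) (Z n) (g n))
    (h0 : ∀ᶠ n : ℕ in atTop, ∀ k, ‖Z n 0 k‖ ≤ (n : ℝ) ^ A)
    (hT : ∀ᶠ n : ℕ in atTop, ∀ j < m n, ∑ k, g n j k ≤ (n : ℝ) ^ 4)
    (hV : ∀ᶠ n : ℕ in atTop,
      volume.real (smallCauchySumSet (m n) (Z n) (g n) n ((n : ℝ) ^ q)⁻¹) ≤ ((n : ℝ) ^ 2)⁻¹)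
    (N : ℝ) : Tendsto (fun n : ℕ =>
      (∫ x in Metric.closedBall 0 N, |logPotentialSub (Z n (m n)) (Z n 0) x|) / n)
      atTop (𝓝 0) := by
  have hinv : Tendsto (fun n : ℕ => ((n : ℝ))⁻¹) atTop (𝓝 0) :=
    tendsto_inv_atTop_zero.comp tendsto_natCast_atTop_atTop
  have hinv2 : Tendsto (fun n : ℕ => ((n : ℝ) ^ 2)⁻¹) atTop (𝓝 0) := by
    simpa using hinv.pow 2
  have hlog2 : Tendsto (fun n : ℕ => Real.log n * ((n : ℝ) ^ 2)⁻¹) atTop (𝓝 0) := by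
    have h1 : Tendsto (fun x : ℝ => Real.log x ^ 1 / (1 * x + 0)) atTop (𝓝 0) :=
      Real.tendsto_pow_log_div_mul_add_atTop 1 0 1 one_ne_zero
    have h2 := (h1.comp (tendsto_natCast_atTop_atTop (R := ℝ))).mul hinv
    rw [mul_zero] at h2
    refine h2.congr fun n => ?_
    simp only [Function.comp, pow_one, one_mul, add_zero, div_eq_mul_inv, sq, mul_inv, mul_assoc]
  have hbound : Tendsto (fun n : ℕ =>
      ((m n : ℝ) / ((n : ℝ) / Real.log n)) * ((q + 4) * volume.real (Metric.closedBall (0 : ℂ) N))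
      + 2 * ((A + 2) * 5 * (Real.log n * ((n : ℝ) ^ 2)⁻¹) +
        (n : ℝ)⁻¹ * (discInvNormIntegral + 5 * ((n : ℝ) ^ 2)⁻¹))) atTop (𝓝 0) := by
    have := (hm.mul_const ((q + 4) * volume.real (Metric.closedBall (0 : ℂ) N))).add
      (((hlog2.const_mul (((A : ℝ) + 2) * 5)).add
        (hinv.mul ((hinv2.const_mul 5).const_add discInvNormIntegral))).const_mul 2)
    simpa using this
  refine squeeze_zero' (Eventually.of_forall fun n =>
    div_nonneg (integral_nonneg fun _ => abs_nonneg _) (Nat.cast_nonneg n)) ?_ hbound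
  filter_upwards [h, h0, hT, hV, eventually_ge_atTop 2, eventually_ge_atTop ⌈N⌉₊]
    with n h h0 hT hV hn hN
  have hn0 : (0 : ℝ) < n := by exact_mod_cast (by omega : 0 < n)
  have := h.setIntegral_abs_logPotentialSub_le hn hA h0 hT hV (Nat.ceil_le.1 hN)
  rw [div_le_iff₀ hn0]
  refine this.trans_eq ?_
  rw [div_div_eq_mul_div]
  field_simp

/-! ### Empirical measures and weak convergence -/

/-- The proportion of the points of the family `w` that lie in `s`. -/
noncomputable def frequency {d : ℕ} (w : Fin d → ℂ) (s : Set ℂ) : ℝ :=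
  (∑ k, s.indicator (fun _ => (1 : ℝ)) (w k)) / d

theorem frequency_mono {d : ℕ} (w : Fin d → ℂ) {s t : Set ℂ} (h : s ⊆ t) :
    frequency w s ≤ frequency w t :=
  div_le_div_of_nonneg_right (Finset.sum_le_sum fun k _ =>
    Set.indicator_le_indicator_of_subset h (fun _ => zero_le_one) (w k)) (Nat.cast_nonneg d)

theorem sum_frequency_le {d : ℕ} (w : Fin d → ℂ) {ι : Type*} (F : Finset ι) {s : ι → Set ℂ}
    {t : Set ℂ} (hst : ∀ i ∈ F, s i ⊆ t) (hd : (F : Set ι).PairwiseDisjoint s) :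
    ∑ i ∈ F, frequency w (s i) ≤ frequency w t := by
  have hU : ⋃ i ∈ F, s i ⊆ t := Set.iUnion₂_subset hst
  refine le_trans (le_of_eq ?_) (frequency_mono w hU)
  simp only [frequency]
  rw [← Finset.sum_div, Finset.sum_comm]
  congr 1
  refine Finset.sum_congr rfl fun k _ => ?_
  rw [Finset.indicator_biUnion_apply F s fun i hi j hj hij => hd hi hj hij]

theorem coe_empiricalMeasure_apply {d : ℕ} (w : Fin d → ℂ) {s : Set ℂ} (hs : MeasurableSet s) :
    (empiricalMeasure w : Measure ℂ) s = ENNReal.ofReal (frequency w s) := by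
  have h1 : (empiricalMeasure w : Measure ℂ) s =
      ((d : NNReal)⁻¹ : NNReal) * ∑ k, s.indicator (fun _ => (1 : ENNReal)) (w k) := by
    rw [empiricalMeasure, FiniteMeasure.toMeasure_smul, FiniteMeasure.toMeasure_sum,
      Measure.smul_apply, Measure.finsetSum_apply]
    rw [ENNReal.smul_def, smul_eq_mul]
    congr 1
    refine Finset.sum_congr rfl fun k _ => ?_
    exact diracProba_toMeasure_apply' (w k) hs
  rw [h1, frequency, div_eq_inv_mul, ENNReal.ofReal_mul (by positivity),
    ENNReal.ofReal_sum_of_nonneg fun k _ => Set.indicator_nonneg (fun _ _ => zero_le_one) _]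
  congr 1
  · rw [← NNReal.coe_natCast, ← NNReal.coe_inv, ENNReal.ofReal_coe_nnreal]
  · refine Finset.sum_congr rfl fun k _ => ?_
    by_cases h : w k ∈ s <;> simp [h]

theorem isProbabilityMeasure_empiricalMeasure {d : ℕ} (hd : d ≠ 0) (w : Fin d → ℂ) :
    IsProbabilityMeasure (empiricalMeasure w : Measure ℂ) := by
  constructor
  rw [coe_empiricalMeasure_apply w MeasurableSet.univ, frequency]
  have : (d : ℝ) ≠ 0 := by exact_mod_cast hd
  simp [this]

/-- Inner regularity: a compact subset of the open ball already carries mass above `a`, and it sits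
in a strictly smaller concentric ball. -/
theorem exists_ball_subset_lt_measure (ν : Measure ℂ) [IsFiniteMeasure ν] (c : ℂ) {r : ℝ}
    (hr : 0 < r) {a : ℝ} (ha : a < ν.real (Metric.ball c r)) :
    ∃ s, 0 < s ∧ s < r ∧ a < ν.real (Metric.ball c s) := by
  rcases lt_or_ge a 0 with h0 | h0
  · exact ⟨r / 2, by linarith, by linarith, h0.trans_le measureReal_nonneg⟩
  have h1 : ENNReal.ofReal a < ν (Metric.ball c r) := by
    rw [← ENNReal.ofReal_toReal (measure_ne_top ν (Metric.ball c r))]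
    exact (ENNReal.ofReal_lt_ofReal_iff (h0.trans_lt ha)).2 ha
  obtain ⟨K, hKU, hK, haK⟩ := Metric.isOpen_ball.exists_lt_isCompact h1
  obtain ⟨s, hsr, hs⟩ := exists_lt_subset_ball hK.isClosed hKU
  refine ⟨max s (r / 2), lt_max_of_lt_right (by linarith), max_lt hsr (by linarith), ?_⟩
  have h2 := haK.trans_le (measure_mono (hs.trans (Metric.ball_subset_ball (le_max_left s (r / 2)))))
  exact (ENNReal.ofReal_lt_iff_lt_toReal h0 (measure_ne_top _ _)).1 h2

/-- An open set contains finitely many disjoint balls that carry almost all of its mass. -/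
theorem exists_finset_disjoint_balls (ν : Measure ℂ) [IsFiniteMeasure ν] {U : Set ℂ}
    (hU : IsOpen U) {a : ENNReal} (ha : a < ν U) :
    ∃ (F : Finset ℂ) (r : ℂ → ℝ), (∀ x ∈ F, 0 < r x ∧ Metric.ball x (r x) ⊆ U) ∧
      (F : Set ℂ).PairwiseDisjoint (fun x => Metric.ball x (r x)) ∧
      a < ∑ x ∈ F, ν (Metric.ball x (r x)) := by
  -- Besicovitch covering with radii whose spheres are `ν`-null, so that the closed balls it
  -- produces can be replaced by open ones without loss of mass.
  obtain ⟨t, r, htc, htU, hr, hcov, hdisj⟩ := Besicovitch.exists_disjoint_closedBall_covering_ae ν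
    (fun x => {r | Metric.closedBall x r ⊆ U ∧ ν (frontier (Metric.ball x r)) = 0}) U
    (by
      intro x hx δ hδ
      obtain ⟨ρ, hρ, hρU⟩ := Metric.nhds_basis_closedBall.mem_iff.1 (hU.mem_nhds hx)
      obtain ⟨r, hr, hrν⟩ := exists_null_frontier_thickening ν {x} (lt_min hδ hρ)
      rw [Metric.thickening_singleton] at hrν
      exact ⟨r, ⟨(Metric.closedBall_subset_closedBall (hr.2.le.trans (min_le_right _ _))).trans hρU,
        hrν⟩, hr.1, hr.2.trans_le (min_le_left _ _)⟩) (fun _ => 1) (fun _ _ => one_pos)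
  have hball : ∀ x ∈ t, ν (Metric.closedBall x (r x)) = ν (Metric.ball x (r x)) := by
    intro x hx
    obtain ⟨⟨-, h0⟩, hpos, -⟩ := hr x hx
    rw [frontier_ball x hpos.ne'] at h0
    rw [← Metric.ball_union_sphere]
    exact measure_congr (union_ae_eq_left_of_ae_eq_empty (ae_eq_empty.2 h0))
  have hle : ν U ≤ ∑' x : t, ν (Metric.ball (x : ℂ) (r x)) := by
    calc ν U ≤ ν (U \ ⋃ x ∈ t, Metric.closedBall x (r x)) +
          ν (⋃ x ∈ t, Metric.closedBall x (r x)) := by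
          refine (measure_mono ?_).trans (measure_union_le _ _)
          intro x hx
          by_cases h : x ∈ ⋃ x ∈ t, Metric.closedBall x (r x)
          · exact Or.inr h
          · exact Or.inl ⟨hx, h⟩
      _ = ∑' x : t, ν (Metric.closedBall (x : ℂ) (r x)) := by
          rw [hcov, zero_add,
            measure_biUnion htc hdisj fun x _ => measurableSet_closedBall]
      _ = _ := tsum_congr fun x => hball x x.2
  have := ha.trans_le hle
  rw [ENNReal.tsum_eq_iSup_sum, lt_iSup_iff] at this
  obtain ⟨F, hF⟩ := this
  have hFt : ∀ x ∈ F.map (Function.Embedding.subtype _), x ∈ t := by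
    intro x hx
    obtain ⟨y, -, rfl⟩ := Finset.mem_map.1 hx
    exact y.2
  refine ⟨F.map (Function.Embedding.subtype _), r, fun x hx => ⟨(hr x (hFt x hx)).2.1,
    Metric.ball_subset_closedBall.trans (hr x (hFt x hx)).1.1⟩, ?_, by simpa using hF⟩
  intro x hx y hy hxy
  exact (hdisj (hFt x (by simpa using hx)) (hFt y (by simpa using hy)) hxy).mono
    Metric.ball_subset_closedBall Metric.ball_subset_closedBall

/-- Weak convergence of empirical measures follows from asymptotic lower bounds for balls. -/
theorem tendsto_empiricalMeasure_of_ball (μ : ProbabilityMeasure ℂ) {e : ℕ → ℕ}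
    (he : ∀ᶠ n in atTop, e n ≠ 0) (w : (n : ℕ) → Fin (e n) → ℂ)
    (h : ∀ (c : ℂ) (s r : ℝ), 0 < s → s < r → ∀ ε > 0, ∀ᶠ n in atTop,
      (μ : Measure ℂ).real (Metric.ball c s) - ε ≤ frequency (w n) (Metric.ball c r)) :
    Tendsto (fun n => empiricalMeasure (w n)) atTop (𝓝 μ.toFiniteMeasure) := by
  classical
  have hball : ∀ (c : ℂ) (r : ℝ), 0 < r → ∀ ε > 0, ∀ᶠ n in atTop,
      (μ : Measure ℂ).real (Metric.ball c r) - ε ≤ frequency (w n) (Metric.ball c r) := by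
    intro c r hr ε hε
    obtain ⟨s, hs, hsr, hlt⟩ := exists_ball_subset_lt_measure (μ : Measure ℂ) c hr
      (a := (μ : Measure ℂ).real (Metric.ball c r) - ε / 2) (by linarith)
    filter_upwards [h c s r hs hsr (ε / 2) (by linarith)] with n hn
    linarith
  -- The default value `μ` only fills the indices with `e n = 0`, so that the portmanteau criterion
  -- for probability measures applies.
  let ν : ℕ → ProbabilityMeasure ℂ := fun n =>
    if hn : e n ≠ 0 then
      ⟨(empiricalMeasure (w n) : Measure ℂ), isProbabilityMeasure_empiricalMeasure hn (w n)⟩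
    else μ
  have hν : ∀ n, e n ≠ 0 → (ν n : Measure ℂ) = (empiricalMeasure (w n) : Measure ℂ) := by
    intro n hn
    have : ν n = ⟨(empiricalMeasure (w n) : Measure ℂ),
        isProbabilityMeasure_empiricalMeasure hn (w n)⟩ := dif_pos hn
    rw [this, ProbabilityMeasure.coe_mk]
  have hlim : Tendsto ν atTop (𝓝 μ) := by
    refine tendsto_of_forall_isOpen_le_liminf' fun G hG => ?_
    refine le_of_forall_lt fun a ha => ?_
    obtain ⟨b, hab, hb⟩ := exists_between ha
    refine hab.trans_le ?_
    obtain ⟨F, r, hF, hdisj, hsum⟩ := exists_finset_disjoint_balls (μ : Measure ℂ) hG hb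
    refine le_liminf_of_le (by isBoundedDefault) ?_
    have hsum' : b.toReal < ∑ x ∈ F, (μ : Measure ℂ).real (Metric.ball x (r x)) := by
      have hne : ∑ x ∈ F, (μ : Measure ℂ) (Metric.ball x (r x)) ≠ ⊤ :=
        ENNReal.sum_ne_top.2 fun x _ => measure_ne_top _ _
      have := (ENNReal.toReal_lt_toReal hsum.ne_top hne).2 hsum
      rwa [ENNReal.toReal_sum fun x _ => measure_ne_top _ _] at this
    set gap := ∑ x ∈ F, (μ : Measure ℂ).real (Metric.ball x (r x)) - b.toReal with hgap
    -- The loss is shared among the balls; the `+ 1` avoids division by zero when `F` is empty.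
    have hε : 0 < gap / (F.card + 1) := div_pos (by linarith) (by positivity)
    have hev : ∀ᶠ n in atTop, ∀ x ∈ F, (μ : Measure ℂ).real (Metric.ball x (r x))
        - gap / (F.card + 1) ≤ frequency (w n) (Metric.ball x (r x)) :=
      (Filter.eventually_all_finset F).2 fun x hx => hball x (r x) (hF x hx).1 _ hε
    filter_upwards [hev, he] with n hn hen
    rw [hν n hen, coe_empiricalMeasure_apply _ hG.measurableSet]
    refine (ENNReal.le_ofReal_iff_toReal_le hsum.ne_top ?_).2 ?_
    · exact div_nonneg (Finset.sum_nonneg fun k _ =>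
        Set.indicator_nonneg (fun _ _ => zero_le_one) _) (Nat.cast_nonneg _)
    · have h1 := Finset.sum_le_sum hn
      rw [Finset.sum_sub_distrib, Finset.sum_const, nsmul_eq_mul] at h1
      have h2 := sum_frequency_le (w n) F (fun x hx => (hF x hx).2) hdisj
      have h3 : F.card * (gap / (F.card + 1)) ≤ gap := by
        rw [mul_div_assoc', div_le_iff₀ (by positivity)]
        nlinarith
      linarith
  rw [ProbabilityMeasure.tendsto_nhds_iff_toFiniteMeasure_tendsto_nhds] at hlim
  refine hlim.congr' ?_
  filter_upwards [he] with n hn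
  refine FiniteMeasure.toMeasure_injective ?_
  exact hν n hn

/-! ### Borel–Cantelli and the frequencies of the initial points -/

/-- A Borel–Cantelli lemma with summable bounds, valid from some rank on. -/
theorem ae_eventually_notMem_of_le {Ω : Type*} [MeasurableSpace Ω] {P : Measure Ω}
    {s : ℕ → Set Ω} {f : ℕ → ℝ} (hf : Summable f) (hf0 : ∀ n, 0 ≤ f n) {n₀ : ℕ}
    (h : ∀ n, n₀ ≤ n → P (s n) ≤ ENNReal.ofReal (f n)) : ∀ᵐ ω ∂P, ∀ᶠ n in atTop, ω ∉ s n := by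
  have hsum : ∑' n, P (s (n + n₀)) ≠ ⊤ := by
    refine ne_top_of_le_ne_top ?_ (ENNReal.tsum_le_tsum fun n => h (n + n₀) (Nat.le_add_left _ _))
    have := ((summable_nat_add_iff n₀).2 hf)
    rw [← ENNReal.ofReal_tsum_of_nonneg (fun n => hf0 _) this]
    exact ENNReal.ofReal_ne_top
  filter_upwards [ae_eventually_notMem hsum] with ω hω
  rw [eventually_atTop] at hω ⊢
  obtain ⟨N, hN⟩ := hω
  refine ⟨N + n₀, fun n hn => ?_⟩
  have := hN (n - n₀) (by omega)
  rwa [Nat.sub_add_cancel (by omega)] at this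

section IID

variable {Ω : Type*} [MeasurableSpace Ω] {P : Measure Ω} [IsProbabilityMeasure P]
  {μ : ProbabilityMeasure ℂ}

/-- Hoeffding's inequality: a centred variable with values in an interval of length `1` is
sub-Gaussian with parameter `1 / 4`. -/
theorem measure_frequency_le {d : ℕ} (hd : d ≠ 0) {X : Fin d → Ω → ℂ} (hX : ∀ k, Measurable (X k))
    (hlaw : ∀ k, P.map (X k) = (μ : Measure ℂ)) (hind : iIndepFun X P) {G : Set ℂ}
    (hG : MeasurableSet G) {ε : ℝ} (hε : 0 < ε) :
    P {ω | frequency (fun k => X k ω) G ≤ (μ : Measure ℂ).real G - ε} ≤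
      ENNReal.ofReal (Real.exp (-2 * ε ^ 2) ^ d) := by
  have hd0 : (0 : ℝ) < d := by exact_mod_cast Nat.pos_of_ne_zero hd
  -- The sign turns the lower deviation into the upper deviation that the sub-Gaussian bound
  -- controls.
  let f : ℂ → ℝ := fun z => -G.indicator (fun _ => (1 : ℝ)) z
  have hfm : Measurable f := (measurable_const.indicator hG).neg
  have hint : ∀ k, ∫ ω, f (X k ω) ∂P = -(μ : Measure ℂ).real G := by
    intro k
    rw [← integral_map (hX k).aemeasurable (f := f) (by rw [hlaw k]; exact hfm.aestronglyMeasurable),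
      hlaw k]
    simp only [f]
    rw [integral_neg, integral_indicator hG]
    simp
  have hsub : ∀ k, HasSubgaussianMGF (fun ω => f (X k ω) + (μ : Measure ℂ).real G)
      ((‖(0 : ℝ) - (-1)‖₊ / 2) ^ 2) P := by
    intro k
    have := hasSubgaussianMGF_of_mem_Icc (μ := P) (X := fun ω => f (X k ω)) (a := -1) (b := 0)
      (hfm.comp (hX k)).aemeasurable (ae_of_all _ fun ω => by
        simp only [f]
        by_cases h : X k ω ∈ G <;> simp [h])
    rw [hint k] at this
    simpa only [sub_neg_eq_add] using this
  have hind' : iIndepFun (fun k ω => f (X k ω) + (μ : Measure ℂ).real G) P :=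
    hind.comp (fun _ z => f z + (μ : Measure ℂ).real G) fun _ => hfm.add_const _
  have key := HasSubgaussianMGF.measure_sum_ge_le_of_iIndepFun hind' (s := Finset.univ)
    (fun k _ => hsub k) (ε := d * ε) (by positivity)
  have hset : {ω | frequency (fun k => X k ω) G ≤ (μ : Measure ℂ).real G - ε} ⊆
      {ω | d * ε ≤ ∑ k, (f (X k ω) + (μ : Measure ℂ).real G)} := by
    intro ω hω
    simp only [frequency, Set.mem_ofPred_eq, div_le_iff₀ hd0] at hω ⊢
    simp only [f, Finset.sum_add_distrib, Finset.sum_neg_distrib, Finset.sum_const,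
      Finset.card_univ, Fintype.card_fin, nsmul_eq_mul]
    nlinarith
  rw [← ENNReal.ofReal_toReal (measure_ne_top P _)]
  refine ENNReal.ofReal_le_ofReal ((measureReal_mono hset).trans (key.trans_eq ?_))
  rw [← Real.exp_nat_mul]
  congr 1
  simp only [Finset.sum_const, Finset.card_univ, Fintype.card_fin, nsmul_eq_mul]
  have hnorm : ‖(0 : ℝ) - (-1)‖ = 1 := by norm_num
  push_cast
  rw [hnorm]
  field_simp

/-- Almost sure lower bounds for the frequencies of all balls in a triangular array with
i.i.d. rows. -/
theorem ae_eventually_sub_le_frequency {X : (n : ℕ) → Fin n → Ω → ℂ}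
    (hX : ∀ n, 2 ≤ n → ∀ k, Measurable (X n k))
    (hlaw : ∀ n, 2 ≤ n → ∀ k, P.map (X n k) = (μ : Measure ℂ))
    (hind : ∀ n, 2 ≤ n → iIndepFun (X n) P) :
    ∀ᵐ ω ∂P, ∀ (c : ℂ) (s r : ℝ), s < r → ∀ ε > 0, ∀ᶠ n in atTop,
      (μ : Measure ℂ).real (Metric.ball c s) - ε ≤
        frequency (fun k => X n k ω) (Metric.ball c r) := by
  -- A countable family of centres, radii and tolerances gives one null set; the margin `s < r` lets
  -- such a ball fit between the two given ones.
  have hcount : ∀ᵐ ω ∂P, ∀ (i : ℕ) (q : ℚ) (l : ℕ), ∀ᶠ n in atTop,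
      ω ∉ {ω | frequency (fun k => X n k ω) (Metric.ball (TopologicalSpace.denseSeq ℂ i) q) ≤
        (μ : Measure ℂ).real (Metric.ball (TopologicalSpace.denseSeq ℂ i) q)
          - 1 / ((l : ℝ) + 1)} := by
    rw [ae_all_iff]; intro i
    rw [ae_all_iff]; intro q
    rw [ae_all_iff]; intro l
    have hl : 0 < 1 / ((l : ℝ) + 1) := by positivity
    refine ae_eventually_notMem_of_le
      (f := fun n => Real.exp (-2 * (1 / ((l : ℝ) + 1)) ^ 2) ^ n) (n₀ := 2)
      (summable_geometric_of_lt_one (Real.exp_pos _).le (Real.exp_lt_one_iff.2 (by nlinarith [pow_pos hl 2])))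
      (fun n => by positivity) fun n hn => ?_
    exact measure_frequency_le (by omega) (hX n hn) (hlaw n hn) (hind n hn) measurableSet_ball hl
  filter_upwards [hcount] with ω hω c s r hsr ε hε
  obtain ⟨q, hq1, hq2⟩ := exists_rat_btwn hsr
  set η := min (q - s) (r - q) with hη
  have hη0 : 0 < η := lt_min (by linarith) (by linarith)
  obtain ⟨i, hi⟩ := (TopologicalSpace.denseRange_denseSeq ℂ).exists_dist_lt c hη0
  obtain ⟨l, hl⟩ := exists_nat_one_div_lt hε
  have hsub1 : Metric.ball c s ⊆ Metric.ball (TopologicalSpace.denseSeq ℂ i) q :=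
    Metric.ball_subset_ball' (by linarith [min_le_left (q - s) (r - q)])
  have hsub2 : Metric.ball (TopologicalSpace.denseSeq ℂ i) q ⊆ Metric.ball c r :=
    Metric.ball_subset_ball' (by rw [dist_comm]; linarith [min_le_right (q - s) (r - q)])
  filter_upwards [hω i q l] with n hn
  simp only [not_le] at hn
  have h1 := measureReal_mono (μ := (μ : Measure ℂ)) hsub1
  have h2 := frequency_mono (fun k => X n k ω) hsub2
  linarith

end IID

/-! ### Small intervals, mean and positivity for Gamma laws -/

section Gamma

theorem exists_rpow_mul_exp_neg_le (p : ℝ) :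
    ∃ C : ℝ, 0 < C ∧ ∀ t : ℝ, 0 < t → t ^ p * Real.exp (-t) ≤ C * t ^ (min p 0) := by
  rcases le_or_gt p 0 with hp | hp
  · refine ⟨1, one_pos, fun t ht => ?_⟩
    rw [min_eq_left hp, one_mul]
    exact mul_le_of_le_one_right (by positivity) (Real.exp_le_one_iff.2 (by linarith))
  · obtain ⟨k, hk⟩ := exists_nat_ge p
    refine ⟨1 + k.factorial, by positivity, fun t ht => ?_⟩
    rw [min_eq_right hp.le, Real.rpow_zero, mul_one, Real.exp_neg, ← div_eq_mul_inv,
      div_le_iff₀ (Real.exp_pos t)]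
    have h1 : 1 ≤ Real.exp t := Real.one_le_exp ht.le
    have h2 : t ^ k ≤ k.factorial * Real.exp t := by
      have := Real.pow_div_factorial_le_exp t ht.le k
      rwa [div_le_iff₀ (by positivity), mul_comm] at this
    have h3 : t ^ p ≤ 1 + t ^ k := by
      rcases le_total t 1 with h | h
      · have := Real.rpow_le_one ht.le h hp.le
        have := pow_pos ht k
        linarith
      · have := Real.rpow_le_rpow_of_exponent_le h hk
        rw [Real.rpow_natCast] at this
        linarith
    nlinarith

theorem rpow_sub_rpow_le {κ u v : ℝ} (hκ : 0 < κ) (hκ1 : κ ≤ 1) (hu : 0 ≤ u) (huv : u ≤ v) :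
    v ^ κ - u ^ κ ≤ (v - u) ^ κ := by
  have := Real.rpow_add_le_add_rpow hu (sub_nonneg.2 huv) hκ.le hκ1
  rw [add_sub_cancel] at this
  linarith

/-- Gamma distributions give mass at most `C δ ^ κ` to the intervals of length `2 δ`. -/
theorem exists_gammaMeasure_Icc_le {a : ℝ} (ha : 0 < a) :
    ∃ C κ : ℝ, 0 < C ∧ 0 < κ ∧ ∀ x δ : ℝ, 0 ≤ δ →
      gammaMeasure a 1 (Set.Icc (x - δ) (x + δ)) ≤ ENNReal.ofReal (C * δ ^ κ) := by
  obtain ⟨C, hC, hbound⟩ := exists_rpow_mul_exp_neg_le (a - 1)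
  -- Thus `κ = min a 1`: the density is at most a multiple of `t ^ (κ - 1)`, also when it is
  -- unbounded at `0`, and `κ ≤ 1` makes `t ^ κ` subadditive.
  set κ := min (a - 1) 0 + 1 with hκdef
  have hκ : 0 < κ := by
    have : -1 < min (a - 1) 0 := lt_min (by linarith) (by norm_num)
    linarith
  have hκ1 : κ ≤ 1 := by linarith [min_le_right (a - 1) 0]
  have hΓ := Real.Gamma_pos_of_pos ha
  set D := C / Real.Gamma a with hD
  have hD0 : 0 < D := by positivity
  refine ⟨D / κ * 2 ^ κ, κ, by positivity, hκ, fun x δ hδ => ?_⟩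
  rw [gammaMeasure, withDensity_apply _ measurableSet_Icc]
  rcases lt_or_ge (x + δ) 0 with hneg | hv
  · refine le_trans (le_of_eq ?_) zero_le
    rw [setLIntegral_congr_fun (g := fun _ => 0) measurableSet_Icc, lintegral_zero]
    intro t ht
    exact gammaPDF_of_neg (ht.2.trans_lt hneg)
  set u := max (x - δ) 0 with hu
  have hu0 : 0 ≤ u := le_max_right _ _
  have huv : u ≤ x + δ := max_le (by linarith) hv
  have hint : IntervalIntegrable (fun t : ℝ => D * t ^ (κ - 1)) volume u (x + δ) :=
    (intervalIntegral.intervalIntegrable_rpow' (by linarith)).const_mul D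
  have hval : ∫ t in Set.Ioc u (x + δ), D * t ^ (κ - 1) = D * (((x + δ) ^ κ - u ^ κ) / κ) := by
    rw [← intervalIntegral.integral_of_le huv, intervalIntegral.integral_const_mul,
      integral_rpow (Or.inl (by linarith)), sub_add_cancel]
  have hstep : ∫⁻ t in Set.Icc (x - δ) (x + δ), gammaPDF a 1 t ≤
      ∫⁻ t in Set.Ioc u (x + δ), ENNReal.ofReal (D * t ^ (κ - 1)) := by
    rw [← lintegral_indicator measurableSet_Icc, ← lintegral_indicator measurableSet_Ioc]
    refine lintegral_mono_ae ?_
    filter_upwards [(Set.countable_singleton u).ae_notMem volume] with t htu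
    by_cases ht : t ∈ Set.Icc (x - δ) (x + δ)
    · rw [Set.indicator_of_mem ht]
      rcases lt_or_ge t 0 with h0 | h0
      · rw [gammaPDF_of_neg h0]; exact zero_le
      · have hut : u < t := lt_of_le_of_ne (max_le ht.1 h0) fun h => htu h.symm
        have hmem : t ∈ Set.Ioc u (x + δ) := ⟨hut, ht.2⟩
        rw [Set.indicator_of_mem hmem, gammaPDF_of_nonneg h0]
        refine ENNReal.ofReal_le_ofReal ?_
        have := hbound t (hu0.trans_lt hut)
        rw [Real.one_rpow, one_mul, hκdef, add_sub_cancel_right, hD]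
        calc 1 / Real.Gamma a * t ^ (a - 1) * Real.exp (-t)
            = (t ^ (a - 1) * Real.exp (-t)) / Real.Gamma a := by ring
          _ ≤ (C * t ^ min (a - 1) 0) / Real.Gamma a := by gcongr
          _ = _ := by ring
    · rw [Set.indicator_of_notMem ht]; exact zero_le
  refine hstep.trans ?_
  rw [← ofReal_integral_eq_lintegral_ofReal
    ((intervalIntegrable_iff_integrableOn_Ioc_of_le huv).1 hint), hval]
  · refine ENNReal.ofReal_le_ofReal ?_
    have h1 := rpow_sub_rpow_le hκ hκ1 hu0 huv
    have h2 : (x + δ - u) ^ κ ≤ (2 * δ) ^ κ :=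
      Real.rpow_le_rpow (by linarith) (by linarith [le_max_left (x - δ) 0]) hκ.le
    rw [Real.mul_rpow (by norm_num) hδ] at h2
    calc D * (((x + δ) ^ κ - u ^ κ) / κ) ≤ D * ((2 ^ κ * δ ^ κ) / κ) := by gcongr; linarith
      _ = _ := by ring
  · refine (ae_restrict_iff' measurableSet_Ioc).2 (ae_of_all _ fun t ht => ?_)
    have : 0 < t := hu0.trans_lt ht.1
    simp only [Pi.zero_apply]
    positivity

/-- The mean of a Gamma distribution. -/
theorem lintegral_ofReal_gammaMeasure {a : ℝ} (ha : 0 < a) :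
    ∫⁻ t, ENNReal.ofReal t ∂(gammaMeasure a 1) = ENNReal.ofReal a := by
  have hpdf : ∀ b : ℝ, Measurable (gammaPDF b 1) := fun b =>
    (measurable_gammaPDFReal b 1).ennreal_ofReal
  rw [gammaMeasure, lintegral_withDensity_eq_lintegral_mul _ (hpdf a) ENNReal.measurable_ofReal]
  have : ∀ t, (gammaPDF a 1 * fun t => ENNReal.ofReal t) t =
      ENNReal.ofReal a * gammaPDF (a + 1) 1 t := by
    intro t
    simp only [Pi.mul_apply]
    rcases lt_or_ge t 0 with ht | ht
    · rw [gammaPDF_of_neg ht, gammaPDF_of_neg ht]; simp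
    · rw [gammaPDF_of_nonneg ht, gammaPDF_of_nonneg ht, ← ENNReal.ofReal_mul' ht,
        ← ENNReal.ofReal_mul ha.le]
      congr 1
      have hΓ := (Real.Gamma_pos_of_pos ha).ne'
      rw [Real.Gamma_add_one ha.ne', add_sub_cancel_right, Real.one_rpow, Real.one_rpow]
      rcases ht.eq_or_lt with rfl | ht
      · rw [Real.zero_rpow ha.ne']; simp
      · rw [Real.rpow_sub_one ht.ne']
        field_simp
  rw [lintegral_congr this, lintegral_const_mul _ (hpdf _),
    lintegral_gammaPDF_eq_one (by linarith) one_pos, mul_one]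

theorem ae_pos_gammaMeasure (a : ℝ) : ∀ᵐ t ∂(gammaMeasure a 1), 0 < t := by
  rw [ae_iff, gammaMeasure]
  have : {t : ℝ | ¬ 0 < t} = Set.Iic 0 := by ext; simp
  rw [this, withDensity_apply _ measurableSet_Iic, ← setLIntegral_congr Iio_ae_eq_Iic]
  exact lintegral_gammaPDF_of_nonpos le_rfl

end Gamma

/-! ### Independence and anti-concentration -/

section Independence

variable {Ω : Type*} [MeasurableSpace Ω] {P : Measure Ω} [IsProbabilityMeasure P]

/-- The joint law of `(V, (X, Y))` is a triple product measure; reassociating and swapping the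
factors gives the claim. -/
theorem indepFun_prodMk_of_indepFun {α β δ : Type*} [MeasurableSpace α] [MeasurableSpace β]
    [MeasurableSpace δ] {X : Ω → α} {Y : Ω → β} {V : Ω → δ} (hX : Measurable X)
    (hY : Measurable Y) (hV : Measurable V) (hXY : IndepFun X Y P)
    (hVXY : IndepFun V (fun ω => (X ω, Y ω)) P) : IndepFun X (fun ω => (V ω, Y ω)) P := by
  have hVY : IndepFun V Y P := hVXY.comp measurable_id measurable_snd
  have e1 := (indepFun_iff_map_prod_eq_prod_map_map hV.aemeasurable
    (hX.prodMk hY).aemeasurable).1 hVXY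
  rw [(indepFun_iff_map_prod_eq_prod_map_map hX.aemeasurable hY.aemeasurable).1 hXY] at e1
  rw [indepFun_iff_map_prod_eq_prod_map_map hX.aemeasurable (hV.prodMk hY).aemeasurable,
    (indepFun_iff_map_prod_eq_prod_map_map hV.aemeasurable hY.aemeasurable).1 hVY]
  have := Measure.isProbabilityMeasure_map (μ := P) hX.aemeasurable
  have := Measure.isProbabilityMeasure_map (μ := P) hY.aemeasurable
  have := Measure.isProbabilityMeasure_map (μ := P) hV.aemeasurable
  have h1 := (measurePreserving_prodAssoc (P.map V) (P.map X) (P.map Y)).symm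
  have h2 := (Measure.measurePreserving_swap (μ := P.map V) (ν := P.map X)).prod
    (MeasurePreserving.id (P.map Y))
  have h3 := measurePreserving_prodAssoc (P.map X) (P.map V) (P.map Y)
  have h4 := h3.comp (h2.comp h1)
  rw [← h4.map_eq, ← e1, Measure.map_map h4.measurable (hV.prodMk (hX.prodMk hY))]
  rfl

/-- A member of an independent family, itself independent of `V`, is independent of `V` and the
other members taken together. -/
theorem indep_comap_sup_iSup {ι β : Type*} [Fintype ι] [MeasurableSpace β] {Γ : ι → Ω → ℝ}
    {V : Ω → β} (hΓ : ∀ i, Measurable (Γ i)) (hV : Measurable V) (hind : iIndepFun Γ P)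
    (hVΓ : IndepFun V (fun ω i => Γ i ω) P) (i₀ : ι) :
    Indep (MeasurableSpace.comap (Γ i₀) inferInstance)
      (MeasurableSpace.comap V inferInstance ⊔
        ⨆ i, ⨆ (_ : i ≠ i₀), MeasurableSpace.comap (Γ i) inferInstance) P := by
  classical
  let T : Finset ι := Finset.univ.erase i₀
  have h0 := hind.indepFun_finset {i₀} T (by simp [T]) hΓ
  let Y : Ω → T → ℝ := fun ω i => Γ i ω
  have hY : Measurable Y := measurable_pi_lambda _ fun i => hΓ i
  have hXY : IndepFun (Γ i₀) Y P :=
    h0.comp (φ := fun f : ({i₀} : Finset ι) → ℝ => f ⟨i₀, Finset.mem_singleton_self i₀⟩)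
      (ψ := id) (measurable_pi_apply (⟨i₀, Finset.mem_singleton_self i₀⟩ : ({i₀} : Finset ι)))
      measurable_id
  have hVXY : IndepFun V (fun ω => (Γ i₀ ω, Y ω)) P :=
    hVΓ.comp (φ := id) (ψ := fun f : ι → ℝ => (f i₀, fun i : T => f i))
      measurable_id ((measurable_pi_apply _).prodMk
        (measurable_pi_lambda _ fun i => measurable_pi_apply _))
  have key := (IndepFun_iff_Indep _ _ _).1
    (indepFun_prodMk_of_indepFun (hΓ i₀) hY hV hXY hVXY)
  refine indep_of_indep_of_le_right key (sup_le ?_ (iSup₂_le fun i hi => ?_))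
  · rintro _ ⟨s, hs, rfl⟩
    exact ⟨Prod.fst ⁻¹' s, measurable_fst hs, rfl⟩
  · rintro _ ⟨s, hs, rfl⟩
    refine ⟨(fun p : β × (T → ℝ) =>
      p.2 ⟨i, Finset.mem_erase.2 ⟨hi, Finset.mem_univ _⟩⟩) ⁻¹' s, ?_, rfl⟩
    exact ((measurable_pi_apply _).comp measurable_snd) hs

/-- By independence and Fubini `W` may be frozen at `w`; the event then says that `X` lies in the
interval of radius `δ` about `-w`. -/
theorem measure_abs_add_le {X W : Ω → ℝ} (hX : Measurable X) (hW : Measurable W)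
    (hXW : IndepFun X W P) {δ : ℝ} {b : ENNReal}
    (hb : ∀ x, P.map X (Set.Icc (x - δ) (x + δ)) ≤ b) : P {ω | |X ω + W ω| ≤ δ} ≤ b := by
  have := Measure.isProbabilityMeasure_map (μ := P) hX.aemeasurable
  have := Measure.isProbabilityMeasure_map (μ := P) hW.aemeasurable
  have hT : MeasurableSet {p : ℝ × ℝ | |p.1 + p.2| ≤ δ} :=
    measurableSet_le (by fun_prop) measurable_const
  have h1 : P {ω | |X ω + W ω| ≤ δ} =
      (P.map fun ω => (X ω, W ω)) {p : ℝ × ℝ | |p.1 + p.2| ≤ δ} := by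
    rw [Measure.map_apply (hX.prodMk hW) hT]; rfl
  rw [h1, (indepFun_iff_map_prod_eq_prod_map_map hX.aemeasurable hW.aemeasurable).1 hXW,
    Measure.prod_apply_symm hT]
  calc ∫⁻ w, P.map X ((fun t => (t, w)) ⁻¹' {p : ℝ × ℝ | |p.1 + p.2| ≤ δ}) ∂(P.map W)
      ≤ ∫⁻ _, b ∂(P.map W) := by
        refine lintegral_mono fun w => (measure_mono fun t ht => ?_).trans (hb (-w))
        have := abs_le.1 (show |t + w| ≤ δ from ht)
        exact ⟨by linarith, by linarith⟩
    _ = b := by simp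

/-- Anti-concentration of a Cauchy sum with a random weight that is independent of the points and
of the other weights. -/
theorem measure_norm_cauchySum_le {Ω : Type*} {m𝓕 mΩ : MeasurableSpace Ω} {P : Measure Ω}
    [IsProbabilityMeasure P] {d : ℕ} {z : Fin d → Ω → ℂ} {g : Fin d → Ω → ℝ} (k₀ : Fin d)
    (h𝓕 : m𝓕 ≤ mΩ)
    (hz : ∀ k, Measurable[m𝓕] (z k)) (hg : ∀ k, k ≠ k₀ → Measurable[m𝓕] (g k))
    (hg₀ : Measurable (g k₀))
    (hind : Indep (MeasurableSpace.comap (g k₀) inferInstance) m𝓕 P) {ε R : ℝ} (hε : 0 ≤ ε)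
    {x : ℂ} {b : ENNReal}
    (hb : ∀ t, P.map (g k₀) (Set.Icc (t - ε * (‖x‖ + R)) (t + ε * (‖x‖ + R))) ≤ b) :
    P {ω | ‖cauchySum (fun k => z k ω) (fun k => g k ω) x‖ ≤ ε ∧ x ≠ z k₀ ω ∧ ‖z k₀ ω‖ ≤ R}
      ≤ b := by
  -- Multiplying the Cauchy sum by `x - z k₀` isolates `g k₀` as a real summand with coefficient
  -- `1`; `W` is the real part of the rest and does not involve `g k₀`.
  let W : Ω → ℝ := fun ω =>
    ((∑ k ∈ Finset.univ.erase k₀, (g k ω : ℂ) / (x - z k ω)) * (x - z k₀ ω)).re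
  have hW : Measurable[m𝓕] W := by
    refine Complex.measurable_re.comp (Measurable.mul (Finset.measurable_sum _ fun k hk => ?_)
      (measurable_const.sub (hz k₀)))
    exact (Complex.measurable_ofReal.comp (hg k (Finset.ne_of_mem_erase hk))).div
      (measurable_const.sub (hz k))
  have hXW : IndepFun (g k₀) W P := by
    rw [IndepFun_iff_Indep]
    exact indep_of_indep_of_le_right hind hW.comap_le
  refine (measure_mono ?_).trans (measure_abs_add_le hg₀ (hW.mono h𝓕 le_rfl) hXW hb)
  rintro ω ⟨hS, hne, hR⟩
  have hne' : x - z k₀ ω ≠ 0 := sub_ne_zero.2 hne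
  have hprod : cauchySum (fun k => z k ω) (fun k => g k ω) x * (x - z k₀ ω) = g k₀ ω +
      (∑ k ∈ Finset.univ.erase k₀, (g k ω : ℂ) / (x - z k ω)) * (x - z k₀ ω) := by
    rw [cauchySum, ← Finset.add_sum_erase _ _ (Finset.mem_univ k₀), add_mul,
      div_mul_cancel₀ _ hne']
  have hre : g k₀ ω + W ω =
      (cauchySum (fun k => z k ω) (fun k => g k ω) x * (x - z k₀ ω)).re := by
    rw [hprod, Complex.add_re, Complex.ofReal_re]
  show |g k₀ ω + W ω| ≤ ε * (‖x‖ + R)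
  rw [hre]
  refine (Complex.abs_re_le_norm _).trans ?_
  rw [norm_mul]
  exact mul_le_mul hS ((norm_sub_le _ _).trans (by linarith)) (norm_nonneg _) hε

/-- Expected area of the set where a random Cauchy sum is small. -/
theorem lintegral_volume_cauchySum_le {d : ℕ} {z : Fin d → Ω → ℂ} {g : Fin d → Ω → ℝ}
    (k₀ : Fin d) (hz : ∀ k, Measurable (z k)) (hg : ∀ k, Measurable (g k)) {ε R N : ℝ}
    {b : ENNReal} (hb : ∀ x ∈ Metric.closedBall (0 : ℂ) N,
      P {ω | ‖cauchySum (fun k => z k ω) (fun k => g k ω) x‖ ≤ ε ∧ x ≠ z k₀ ω ∧ ‖z k₀ ω‖ ≤ R}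
        ≤ b) :
    (Measurable fun ω => volume {x ∈ Metric.closedBall (0 : ℂ) N |
      ‖cauchySum (fun k => z k ω) (fun k => g k ω) x‖ ≤ ε ∧ x ≠ z k₀ ω ∧ ‖z k₀ ω‖ ≤ R}) ∧
    ∫⁻ ω, volume {x ∈ Metric.closedBall (0 : ℂ) N |
      ‖cauchySum (fun k => z k ω) (fun k => g k ω) x‖ ≤ ε ∧ x ≠ z k₀ ω ∧ ‖z k₀ ω‖ ≤ R} ∂P
      ≤ b * volume (Metric.closedBall (0 : ℂ) N) := by
  let T : Set (Ω × ℂ) := {p | p.2 ∈ Metric.closedBall (0 : ℂ) N ∧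
    ‖cauchySum (fun k => z k p.1) (fun k => g k p.1) p.2‖ ≤ ε ∧ p.2 ≠ z k₀ p.1 ∧ ‖z k₀ p.1‖ ≤ R}
  have hS : Measurable fun p : Ω × ℂ => cauchySum (fun k => z k p.1) (fun k => g k p.1) p.2 :=
    measurable_cauchySum.comp ((measurable_pi_lambda _ fun k => (hz k).comp measurable_fst).prodMk
      ((measurable_pi_lambda _ fun k => (hg k).comp measurable_fst).prodMk measurable_snd))
  have hz₀ : Measurable fun p : Ω × ℂ => z k₀ p.1 := (hz k₀).comp measurable_fst
  have hT : MeasurableSet T :=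
    (measurable_snd measurableSet_closedBall).inter
      ((measurableSet_le hS.norm measurable_const).inter
        ((measurableSet_eq_fun measurable_snd hz₀).compl.inter
          (measurableSet_le hz₀.norm measurable_const)))
  refine ⟨measurable_measure_prodMk_left hT, ?_⟩
  have h1 : ∫⁻ ω, volume {x ∈ Metric.closedBall (0 : ℂ) N |
      ‖cauchySum (fun k => z k ω) (fun k => g k ω) x‖ ≤ ε ∧ x ≠ z k₀ ω ∧ ‖z k₀ ω‖ ≤ R} ∂P
      = (P.prod volume) T := (Measure.prod_apply hT).symm
  rw [h1, Measure.prod_apply_symm hT]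
  calc ∫⁻ x, P ((fun ω => (ω, x)) ⁻¹' T)
      ≤ ∫⁻ x, (Metric.closedBall (0 : ℂ) N).indicator (fun _ => b) x := by
        refine lintegral_mono fun x => ?_
        by_cases hx : x ∈ Metric.closedBall (0 : ℂ) N
        · rw [Set.indicator_of_mem hx]
          exact (measure_mono fun ω hω => hω.2).trans (hb x hx)
        · rw [Set.indicator_of_notMem hx]
          refine (measure_mono_null (t := ∅) ?_ measure_empty).le
          exact fun ω hω => (hx hω.1).elim
    _ = _ := by rw [lintegral_indicator measurableSet_closedBall, setLIntegral_const]

end Independence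

/-! ### Measurability with respect to past weights -/

section PastSigmaAlgebra

variable {Ω : Type*} {n M : ℕ} {Z : (j : ℕ) → Fin (n - j) → Ω → ℂ}
  {γ : (j : ℕ) → Fin (n - j) → Ω → ℝ}

/-- The past before step `j` involves only weights of steps `i < j`, hence never the distinguished
weight `γ j k₀`. -/
theorem pastSigmaAlgebra_le {j : ℕ} (hj : j < M) (k₀ : Fin (n - j)) :
    pastSigmaAlgebra (n := n) (Z 0) γ j ≤
      MeasurableSpace.comap (fun ω k => Z 0 k ω) inferInstance ⊔
        ⨆ p : (j : Fin M) × Fin (n - (j : ℕ)), ⨆ (_ : p ≠ ⟨⟨j, hj⟩, k₀⟩),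
          MeasurableSpace.comap (γ p.1 p.2) inferInstance := by
  refine sup_le (le_sup_of_le_left (iSup_le fun k => ?_))
    (le_sup_of_le_right (iSup_le fun i => iSup_le fun k => ?_))
  · rintro _ ⟨s, hs, rfl⟩
    exact ⟨(fun f : Fin (n - 0) → ℂ => f k) ⁻¹' s, measurable_pi_apply _ hs, rfl⟩
  · refine le_iSup₂_of_le
      (⟨⟨i, i.2.trans hj⟩, k⟩ : (j : Fin M) × Fin (n - (j : ℕ))) (fun h => ?_) le_rfl
    have := congrArg (fun p : (j : Fin M) × Fin (n - (j : ℕ)) => (p.1 : ℕ)) h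
    exact absurd this (ne_of_lt i.2)

theorem comap_le_pastSigmaAlgebra
    (hadapt : ∀ j < M, ∀ k, MeasurableSpace.comap (Z (j + 1) k) Complex.measurableSpace ≤
      pastSigmaAlgebra (n := n) (Z 0) γ (j + 1)) {j : ℕ} (hj : j ≤ M) (k : Fin (n - j)) :
    MeasurableSpace.comap (Z j k) Complex.measurableSpace ≤
      pastSigmaAlgebra (n := n) (Z 0) γ j := by
  cases j with
  | zero => exact le_sup_of_le_left (le_iSup_of_le k le_rfl)
  | succ j => exact hadapt j hj k

end PastSigmaAlgebra

/-! ### Summable probability bounds for one row -/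

section Row

variable {Ω : Type*} [MeasurableSpace Ω] {P : Measure Ω}
  {n M : ℕ} {Z : (j : ℕ) → Fin (n - j) → Ω → ℂ} {γ : (j : ℕ) → Fin (n - j) → Ω → ℝ}

theorem le_of_measurable (hZ : ∀ k, Measurable (Z 0 k))
    (hγ : ∀ j < M, ∀ k, Measurable (γ j k)) {j : ℕ} (hj : j < M) (k₀ : Fin (n - j)) :
    MeasurableSpace.comap (fun ω k => Z 0 k ω) inferInstance ⊔
        ⨆ p : (j : Fin M) × Fin (n - (j : ℕ)), ⨆ (_ : p ≠ ⟨⟨j, hj⟩, k₀⟩),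
          MeasurableSpace.comap (γ p.1 p.2) inferInstance ≤ ‹MeasurableSpace Ω› :=
  sup_le (measurable_pi_lambda _ hZ).comap_le
    (iSup₂_le fun p _ => (hγ p.1 p.1.2 p.2).comap_le)

/-- With high probability, the area of the set where one of the Cauchy sums of a row is tiny is
small. -/
theorem measure_volume_smallCauchySumSet_le [IsProbabilityMeasure P] (hn : 2 ≤ n) (hM : M < n) {a C κ : ℝ} (hC : 0 < C)
    (hκ : 0 < κ) (hgamma : ∀ x δ : ℝ, 0 ≤ δ →
      gammaMeasure a 1 (Set.Icc (x - δ) (x + δ)) ≤ ENNReal.ofReal (C * δ ^ κ))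
    (hZ : ∀ k, Measurable (Z 0 k)) (hγ : ∀ j < M, ∀ k, Measurable (γ j k))
    (hlaw : ∀ j < M, ∀ k, P.map (γ j k) = gammaMeasure a 1)
    (hind : iIndepFun (fun p : (j : Fin M) × Fin (n - (j : ℕ)) => γ p.1 p.2) P)
    (hZγ : IndepFun (fun ω k => Z 0 k ω)
      (fun ω (p : (j : Fin M) × Fin (n - (j : ℕ))) => γ p.1 p.2 ω) P)
    (hadapt : ∀ j < M, ∀ k, MeasurableSpace.comap (Z (j + 1) k) Complex.measurableSpace ≤
      pastSigmaAlgebra (n := n) (Z 0) γ (j + 1))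
    {A L : ℕ} (hA : 1 ≤ A) (hL : 7 ≤ L * κ) :
    P {ω | (∀ j < M, ∀ k, ‖Z j k ω‖ ≤ (n : ℝ) ^ A) ∧ ENNReal.ofReal ((n : ℝ) ^ 2)⁻¹ <
      volume (smallCauchySumSet M (fun j k => Z j k ω) (fun j k => γ j k ω) n
        ((n : ℝ) ^ (A + L))⁻¹)} ≤
      ENNReal.ofReal (4 * C * 2 ^ κ * ((n : ℝ) ^ 2)⁻¹) := by
  have hn1 : (1 : ℝ) ≤ n := by exact_mod_cast (by omega : 1 ≤ n)
  have hn0 : (0 : ℝ) < n := by linarith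
  set ε : ℝ := ((n : ℝ) ^ (A + L))⁻¹ with hε
  have hε0 : 0 < ε := by positivity
  let k₀ : (j : Fin M) → Fin (n - (j : ℕ)) := fun j => ⟨0, by omega⟩
  -- The exponent `7` pays for at most `n` steps, a disc of area at most `4 * n ^ 2`, Markov's
  -- inequality at level `n⁻²`, and the summable `n⁻²` that remains.
  let b : ENNReal := ENNReal.ofReal (C * (2 ^ κ * ((n : ℝ) ^ 7)⁻¹))
  let T : Fin M → Ω → Set ℂ := fun j ω => {x ∈ Metric.closedBall (0 : ℂ) n |
    ‖cauchySum (fun k => Z j k ω) (fun k => γ j k ω) x‖ ≤ ε ∧ x ≠ Z j (k₀ j) ω ∧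
      ‖Z j (k₀ j) ω‖ ≤ (n : ℝ) ^ A}
  have hδ : ∀ x ∈ Metric.closedBall (0 : ℂ) n,
      C * (ε * (‖x‖ + (n : ℝ) ^ A)) ^ κ ≤ C * (2 ^ κ * ((n : ℝ) ^ 7)⁻¹) := by
    intro x hx
    have hx' : ‖x‖ ≤ n := mem_closedBall_zero_iff.1 hx
    have hnA : (n : ℝ) ≤ (n : ℝ) ^ A := le_self_pow₀ hn1 (by omega)
    have h1 : ε * (‖x‖ + (n : ℝ) ^ A) ≤ 2 * ((n : ℝ) ^ L)⁻¹ := by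
      calc ε * (‖x‖ + (n : ℝ) ^ A) ≤ ε * (2 * (n : ℝ) ^ A) := by gcongr; linarith
        _ = 2 * ((n : ℝ) ^ L)⁻¹ := by rw [hε, pow_add]; field_simp
    have h2 : (((n : ℝ) ^ L)⁻¹) ^ κ ≤ ((n : ℝ) ^ 7)⁻¹ := by
      rw [Real.inv_rpow (by positivity), ← Real.rpow_natCast, ← Real.rpow_mul hn0.le]
      refine inv_anti₀ (by positivity) ?_
      rw [← Real.rpow_natCast]
      exact Real.rpow_le_rpow_of_exponent_le hn1 (by exact_mod_cast hL)
    calc C * (ε * (‖x‖ + (n : ℝ) ^ A)) ^ κ ≤ C * (2 * ((n : ℝ) ^ L)⁻¹) ^ κ := by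
          gcongr
      _ = C * (2 ^ κ * (((n : ℝ) ^ L)⁻¹) ^ κ) := by
          rw [Real.mul_rpow (by norm_num) (by positivity)]
      _ ≤ _ := by gcongr
  have hT : ∀ j : Fin M, (Measurable fun ω => volume (T j ω)) ∧
      ∫⁻ ω, volume (T j ω) ∂P ≤ b * volume (Metric.closedBall (0 : ℂ) n) := by
    intro j
    have hle := le_of_measurable hZ hγ j.2 (k₀ j)
    have hZj := fun k => measurable_iff_comap_le.2
      ((comap_le_pastSigmaAlgebra hadapt j.2.le k).trans (pastSigmaAlgebra_le j.2 (k₀ j)))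
    refine lintegral_volume_cauchySum_le (k₀ j) (fun k => (hZj k).mono hle le_rfl) (hγ j j.2)
      fun x hx => measure_norm_cauchySum_le (k₀ j) hle hZj (fun k hk => ?_) (hγ j j.2 (k₀ j)) ?_
        hε0.le fun t => ?_
    · rw [measurable_iff_comap_le]
      refine le_sup_of_le_right (le_iSup₂_of_le
        (⟨j, k⟩ : (j : Fin M) × Fin (n - (j : ℕ))) (fun h => hk ?_) le_rfl)
      exact eq_of_heq (Sigma.mk.inj h).2
    · exact indep_comap_sup_iSup (Γ := fun p : (j : Fin M) × Fin (n - (j : ℕ)) => γ p.1 p.2)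
        (fun p => hγ p.1 p.1.2 p.2) (measurable_pi_lambda _ hZ) hind hZγ ⟨j, k₀ j⟩
    · rw [hlaw j j.2]
      exact (hgamma t _ (by positivity)).trans (ENNReal.ofReal_le_ofReal (hδ x hx))
  have hsub : {ω | (∀ j < M, ∀ k, ‖Z j k ω‖ ≤ (n : ℝ) ^ A) ∧ ENNReal.ofReal ((n : ℝ) ^ 2)⁻¹ <
      volume (smallCauchySumSet M (fun j k => Z j k ω) (fun j k => γ j k ω) n ε)} ⊆
      {ω | ENNReal.ofReal ((n : ℝ) ^ 2)⁻¹ ≤ ∑ j, volume (T j ω)} := by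
    rintro ω ⟨hω, hvol⟩
    refine hvol.le.trans ?_
    have hcov : smallCauchySumSet M (fun j k => Z j k ω) (fun j k => γ j k ω) n ε ⊆
        ⋃ j : Fin M, (T j ω ∪ {Z j (k₀ j) ω}) := by
      rintro x ⟨hx, j, hj, hS⟩
      refine Set.mem_iUnion.2 ⟨⟨j, hj⟩, ?_⟩
      -- The pole of the distinguished term, excluded by the anti-concentration bound, is a single
      -- point and has no area.
      by_cases hxz : x = Z j (k₀ ⟨j, hj⟩) ω
      · exact Or.inr hxz
      · exact Or.inl ⟨hx, hS, hxz, hω j hj _⟩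
    refine (measure_mono hcov).trans ((measure_iUnion_fintype_le _ _).trans ?_)
    refine Finset.sum_le_sum fun j _ => (measure_union_le _ _).trans ?_
    rw [measure_singleton, add_zero]
  refine (measure_mono hsub).trans ((meas_ge_le_lintegral_div
    (Finset.measurable_sum _ fun j _ => (hT j).1).aemeasurable ?_ ENNReal.ofReal_ne_top).trans ?_)
  · rw [Ne, ENNReal.ofReal_eq_zero, not_le]
    positivity
  refine ENNReal.div_le_of_le_mul ?_
  rw [lintegral_finsetSum _ fun j _ => (hT j).1]
  refine (Finset.sum_le_card_nsmul _ _ _ fun j _ => (hT j).2).trans ?_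
  have hball : volume (Metric.closedBall (0 : ℂ) n) ≤ ENNReal.ofReal (4 * (n : ℝ) ^ 2) := by
    rw [Complex.volume_closedBall, ENNReal.ofReal_mul (by norm_num), mul_comm,
      ENNReal.ofReal_pow hn0.le]
    gcongr
    rw [← ENNReal.ofReal_coe_nnreal]
    exact ENNReal.ofReal_le_ofReal Real.pi_le_four
  rw [nsmul_eq_mul, Finset.card_univ, Fintype.card_fin]
  calc (M : ENNReal) * (b * volume (Metric.closedBall (0 : ℂ) n))
      ≤ ENNReal.ofReal n * (b * ENNReal.ofReal (4 * (n : ℝ) ^ 2)) := by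
        gcongr
        rw [ENNReal.ofReal_natCast]
        exact_mod_cast hM.le
    _ = ENNReal.ofReal (n * (C * (2 ^ κ * ((n : ℝ) ^ 7)⁻¹) * (4 * (n : ℝ) ^ 2))) := by
        rw [← ENNReal.ofReal_mul (by positivity), ← ENNReal.ofReal_mul (by positivity)]
    _ = _ := by
        rw [← ENNReal.ofReal_mul (by positivity)]
        congr 1
        field_simp

/-- With high probability, the total weights of all steps are at most `n ^ 4`. -/
theorem measure_exists_sum_gt_le (hn : 2 ≤ n) (hM : M < n) {a : ℝ} (ha : 0 < a)
    (hγ : ∀ j < M, ∀ k, Measurable (γ j k))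
    (hlaw : ∀ j < M, ∀ k, P.map (γ j k) = gammaMeasure a 1) :
    P {ω | ∃ j < M, (n : ℝ) ^ 4 < ∑ k, γ j k ω} ≤ ENNReal.ofReal (a * ((n : ℝ) ^ 2)⁻¹) := by
  have hn0 : (0 : ℝ) < n := by exact_mod_cast (by omega : 0 < n)
  have hmeas : ∀ j : Fin M, Measurable fun ω => ∑ k, ENNReal.ofReal (γ j k ω) := fun j =>
    Finset.measurable_sum _ fun k _ => (hγ j j.2 k).ennreal_ofReal
  have hrow : ∀ j : Fin M, ∫⁻ ω, ∑ k, ENNReal.ofReal (γ j k ω) ∂P ≤ ENNReal.ofReal (n * a) := by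
    intro j
    rw [lintegral_finsetSum _ fun k _ => (hγ j j.2 k).ennreal_ofReal]
    have : ∀ k, ∫⁻ ω, ENNReal.ofReal (γ j k ω) ∂P = ENNReal.ofReal a := by
      intro k
      rw [← lintegral_ofReal_gammaMeasure ha, ← hlaw j j.2 k,
        lintegral_map ENNReal.measurable_ofReal (hγ j j.2 k)]
    simp only [this, Finset.sum_const, Finset.card_univ, Fintype.card_fin, nsmul_eq_mul]
    rw [ENNReal.ofReal_mul hn0.le, ENNReal.ofReal_natCast]
    gcongr
    exact Nat.sub_le _ _
  have hsub : {ω | ∃ j < M, (n : ℝ) ^ 4 < ∑ k, γ j k ω} ⊆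
      {ω | ENNReal.ofReal ((n : ℝ) ^ 4) ≤ ∑ j : Fin M, ∑ k, ENNReal.ofReal (γ j k ω)} := by
    rintro ω ⟨j, hj, hlt⟩
    refine (ENNReal.ofReal_le_ofReal hlt.le).trans ((?_ : _ ≤ ∑ k, ENNReal.ofReal (γ j k ω)).trans
      (Finset.single_le_sum (f := fun j : Fin M => ∑ k, ENNReal.ofReal (γ j k ω))
        (fun _ _ => zero_le) (Finset.mem_univ (⟨j, hj⟩ : Fin M))))
    exact Finset.le_sum_of_subadditive ENNReal.ofReal ENNReal.ofReal_zero.le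
      (fun _ _ => ENNReal.ofReal_add_le) _ _
  refine (measure_mono hsub).trans ((meas_ge_le_lintegral_div
    (Finset.measurable_sum _ fun j _ => hmeas j).aemeasurable ?_ ENNReal.ofReal_ne_top).trans ?_)
  · rw [Ne, ENNReal.ofReal_eq_zero, not_le]
    positivity
  refine ENNReal.div_le_of_le_mul ?_
  rw [lintegral_finsetSum _ fun j _ => hmeas j]
  refine (Finset.sum_le_card_nsmul _ _ _ fun j _ => hrow j).trans ?_
  rw [nsmul_eq_mul, Finset.card_univ, Fintype.card_fin, ← ENNReal.ofReal_mul (by positivity),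
    ← ENNReal.ofReal_natCast, ← ENNReal.ofReal_mul (by positivity)]
  refine ENNReal.ofReal_le_ofReal ?_
  have hMn : (M : ℝ) ≤ n := by exact_mod_cast hM.le
  calc (M : ℝ) * (n * a) ≤ n * (n * a) := by gcongr
    _ = _ := by field_simp

/-- With high probability, all initial points have polynomial size. -/
theorem measure_exists_norm_gt_le (hn : 2 ≤ n) {μ : ProbabilityMeasure ℂ}
    (hZ : ∀ k, Measurable (Z 0 k)) (hlaw : ∀ k, P.map (Z 0 k) = (μ : Measure ℂ)) {c K : ℝ}
    (htail : ∀ R : ℝ, 1 ≤ R → R ^ c * (μ : Measure ℂ).real {z : ℂ | R < ‖z‖} ≤ K) {A : ℕ}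
    (hA : 3 ≤ A * c) :
    P {ω | ∃ k, (n : ℝ) ^ A < ‖Z 0 k ω‖} ≤ ENNReal.ofReal (K * ((n : ℝ) ^ 2)⁻¹) := by
  have hn1 : (1 : ℝ) ≤ n := by exact_mod_cast (by omega : 1 ≤ n)
  have hn0 : (0 : ℝ) < n := by linarith
  have hR := htail ((n : ℝ) ^ A) (one_le_pow₀ hn1)
  set S : Set ℂ := {z : ℂ | (n : ℝ) ^ A < ‖z‖} with hS
  have hSm : MeasurableSet S := measurableSet_lt measurable_const measurable_norm
  have hone : (μ : Measure ℂ) S ≤ ENNReal.ofReal (K * ((n : ℝ) ^ 3)⁻¹) := by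
    rw [← ENNReal.ofReal_toReal (measure_ne_top (μ : Measure ℂ) S)]
    refine ENNReal.ofReal_le_ofReal ?_
    -- A tail of order `n⁻³` leaves `n⁻²` after the union bound over `n` points.
    have h3 : (n : ℝ) ^ 3 ≤ ((n : ℝ) ^ A) ^ c := by
      rw [← Real.rpow_natCast, ← Real.rpow_natCast, ← Real.rpow_mul hn0.le]
      exact Real.rpow_le_rpow_of_exponent_le hn1 (by exact_mod_cast hA)
    rw [← div_eq_mul_inv, le_div_iff₀ (by positivity), mul_comm]
    exact (mul_le_mul_of_nonneg_right h3 ENNReal.toReal_nonneg).trans hR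
  have hcov : {ω | ∃ k, (n : ℝ) ^ A < ‖Z 0 k ω‖} ⊆ ⋃ k, (Z 0 k) ⁻¹' S := by
    rintro ω ⟨k, hk⟩
    exact Set.mem_iUnion.2 ⟨k, hk⟩
  refine (measure_mono hcov).trans ((measure_iUnion_fintype_le _ _).trans ?_)
  refine (Finset.sum_le_card_nsmul _ _ (ENNReal.ofReal (K * ((n : ℝ) ^ 3)⁻¹)) fun k _ => ?_).trans ?_
  · rw [← Measure.map_apply (hZ k) hSm, hlaw k]
    exact hone
  · rw [nsmul_eq_mul, Finset.card_univ, Fintype.card_fin, Nat.sub_zero, ← ENNReal.ofReal_natCast,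
      ← ENNReal.ofReal_mul (by positivity)]
    refine ENNReal.ofReal_le_ofReal (le_of_eq ?_)
    field_simp

end Row

/-! ### The main theorem -/

/-- Row `n` consists of points `Z n j k` (`0 ≤ j ≤ m n`, `k < n - j`) and of weights `γ n j k`
(`0 ≤ j < m n`, `k < n - j`); the weights `γ n j` are those of the step from `Z n j` to
`Z n (j + 1)`. -/
theorem theorem3 {Ω : Type*} [MeasurableSpace Ω] (P : Measure Ω) [IsProbabilityMeasure P]
    (β : ℝ) (hβ : 0 < β)
    -- the law of the initial points, with at least polynomially decaying tail
    (μ : ProbabilityMeasure ℂ)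
    (htail : ∃ c : ℝ, 0 < c ∧ ∃ K : ℝ, ∀ R : ℝ, 1 ≤ R →
      R ^ c * (μ : Measure ℂ).real {z : ℂ | R < ‖z‖} ≤ K)
    -- the number of iterations
    (m : ℕ → ℕ) (hm : ∀ n, 2 ≤ n → 1 ≤ m n ∧ m n ≤ n - 1)
    (hm_small : Tendsto (fun n : ℕ => (m n : ℝ) / ((n : ℝ) / Real.log n)) atTop (𝓝 0))
    (Z : (n j : ℕ) → Fin (n - j) → Ω → ℂ)
    (γ : (n j : ℕ) → Fin (n - j) → Ω → ℝ)
    -- in each row, the initial points are i.i.d. with law `μ`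
    (hZ_meas : ∀ n, 2 ≤ n → ∀ k, Measurable (Z n 0 k))
    (hZ_law : ∀ n, 2 ≤ n → ∀ k, P.map (Z n 0 k) = (μ : Measure ℂ))
    (hZ_indep : ∀ n, 2 ≤ n → iIndepFun (fun k => Z n 0 k) P)
    -- in each row, the weights are i.i.d. with the Gamma law of parameter `β / 2`
    (hγ_meas : ∀ n, 2 ≤ n → ∀ j, j < m n → ∀ k, Measurable (γ n j k))
    (hγ_law : ∀ n, 2 ≤ n → ∀ j, j < m n → ∀ k, P.map (γ n j k) = gammaMeasure (β / 2) 1)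
    (hγ_indep : ∀ n, 2 ≤ n →
      iIndepFun (fun p : (j : Fin (m n)) × Fin (n - (j : ℕ)) => γ n p.1 p.2) P)
    -- in each row, the family of weights is independent of the family of initial points
    (hZγ : ∀ n, 2 ≤ n → IndepFun (fun ω k => Z n 0 k ω)
      (fun ω (p : (j : Fin (m n)) × Fin (n - (j : ℕ))) => γ n p.1 p.2 ω) P)
    -- the points of generation `j + 1` are the zeros, with multiplicity, of the randomized
    -- derivative built from the points of generation `j` and from the weights of that step
    (hZ_zeros : ∀ n, 2 ≤ n → ∀ j, j < m n → ∀ᵐ ω ∂P,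
      EnumeratesZeros (fun k => Z n (j + 1) k ω)
        (randomizedDerivative (fun k => Z n j k ω) (fun k => γ n j k ω)))
    -- they are enumerated measurably, without looking at the weights of later steps,
    -- i.e. each of them is measurable for the σ-algebra of the initial points and past weights
    (hZ_adapted : ∀ n, 2 ≤ n → ∀ j, j < m n → ∀ k,
      MeasurableSpace.comap (Z n (j + 1) k) Complex.measurableSpace ≤
        pastSigmaAlgebra (n := n) (Z n 0) (γ n) (j + 1)) :
    ∀ᵐ ω ∂P, Tendsto (fun n : ℕ => empiricalMeasure (fun k => Z n (m n) k ω)) atTop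
      (𝓝 μ.toFiniteMeasure) := by
  obtain ⟨c, hc, K, hK⟩ := htail
  have hmlt : ∀ n, 2 ≤ n → m n < n := fun n hn => by have := hm n hn; omega
  have ha : 0 < β / 2 := by linarith
  obtain ⟨C, κ, hC, hκ, hgamma⟩ := exists_gammaMeasure_Icc_le ha
  obtain ⟨A, hA⟩ := exists_nat_ge (max (3 / c) 1)
  have hA1 : 1 ≤ A := by exact_mod_cast (le_max_right _ _).trans hA
  have hAc : 3 ≤ A * c := (div_le_iff₀ hc).1 ((le_max_left _ _).trans hA)
  obtain ⟨L, hL⟩ := exists_nat_ge (7 / κ)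
  have hLκ : 7 ≤ L * κ := (div_le_iff₀ hκ).1 hL
  have hK0 : 0 ≤ K := le_trans (by positivity) (hK 1 le_rfl)
  have hsum : ∀ D : ℝ, Summable fun n : ℕ => D * ((n : ℝ) ^ 2)⁻¹ := fun D =>
    (Real.summable_nat_pow_inv.2 one_lt_two).mul_left D
  have hnorm := ae_eventually_notMem_of_le (hsum K) (fun n => by positivity) fun n hn =>
    measure_exists_norm_gt_le hn (hZ_meas n hn) (hZ_law n hn) hK hAc
  have hweights := ae_eventually_notMem_of_le (hsum (β / 2)) (fun n => by positivity) fun n hn =>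
    measure_exists_sum_gt_le hn (hmlt n hn) ha (hγ_meas n hn) (hγ_law n hn)
  have harea := ae_eventually_notMem_of_le (hsum (4 * C * 2 ^ κ)) (fun n => by positivity)
    fun n hn => measure_volume_smallCauchySumSet_le hn (hmlt n hn) hC hκ hgamma (hZ_meas n hn)
      (hγ_meas n hn) (hγ_law n hn) (hγ_indep n hn) (hZγ n hn) (hZ_adapted n hn) hA1 hLκ
  have hpos : ∀ᵐ ω ∂P, ∀ n, 2 ≤ n → ∀ j, j < m n → ∀ k, 0 < γ n j k ω := by
    refine ae_all_iff.2 fun n => ae_all_iff.2 fun hn => ae_all_iff.2 fun j =>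
      ae_all_iff.2 fun hj => ae_all_iff.2 fun k => ?_
    refine ae_of_ae_map (hγ_meas n hn j hj k).aemeasurable (p := fun t => 0 < t) ?_
    rw [hγ_law n hn j hj k]
    exact ae_pos_gammaMeasure _
  have hzeros : ∀ᵐ ω ∂P, ∀ n, 2 ≤ n → ∀ j, j < m n → EnumeratesZeros (fun k => Z n (j + 1) k ω)
      (randomizedDerivative (fun k => Z n j k ω) (fun k => γ n j k ω)) :=
    ae_all_iff.2 fun n => ae_all_iff.2 fun hn => ae_all_iff.2 fun j => ae_all_iff.2 fun hj =>
      hZ_zeros n hn j hj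
  have hinit := ae_eventually_sub_le_frequency (P := P) (μ := μ) (X := fun n => Z n 0)
    hZ_meas hZ_law hZ_indep
  filter_upwards [hnorm, hweights, harea, hpos, hzeros, hinit]
    with ω hnorm hweights harea hpos hzeros hinit
  have htri : ∀ n, 2 ≤ n →
      IsDerivativeTriangle (m n) (fun j k => Z n j k ω) (fun j k => γ n j k ω) :=
    fun n hn => ⟨hmlt n hn, hpos n hn, hzeros n hn⟩
  have hZ0 : ∀ᶠ n : ℕ in atTop, ∀ k, ‖Z n 0 k ω‖ ≤ (n : ℝ) ^ A := by
    filter_upwards [hnorm] with n hn k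
    by_contra! hlt
    exact hn ⟨k, hlt⟩
  have hL1 := tendsto_setIntegral_abs_logPotentialSub_div hm_small
    (Z := fun n j k => Z n j k ω) (g := fun n j k => γ n j k ω) (q := A + L) hA1
    (by filter_upwards [eventually_ge_atTop 2] with n hn using htri n hn) hZ0
    (by
      filter_upwards [hweights] with n hn j hj
      by_contra! hlt
      exact hn ⟨j, hj, hlt⟩)
    (by
      filter_upwards [harea, hZ0, eventually_ge_atTop 2] with n hn h0 h2
      refine ENNReal.toReal_le_of_le_ofReal (by positivity) ?_
      by_contra! hlt
      -- The area event was stated on the event that all rows are polynomially bounded; Gauss–Lucas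
      -- deduces this from the first row.
      exact hn ⟨fun j hj k => (htri n h2).norm_le h0 hj.le k, hlt⟩)
  refine tendsto_empiricalMeasure_of_ball μ (e := fun n => n - m n) ?_
    (fun n k => Z n (m n) k ω) fun x s r hs hsr ε hε => ?_
  · filter_upwards [eventually_ge_atTop 2] with n hn
    have := hmlt n hn
    omega
  -- Two enlargements of the ball: from `s` to `t` for the sampling error of the initial row, from
  -- `t` to `r` for the comparison of potentials. Each costs `ε / 2`.
  set t := (s + r) / 2 with ht
  have hst : s < t := by linarith
  have htr : t < r := by linarith
  obtain ⟨K', hK', hcomp⟩ := exists_mul_sum_indicator_ball_le (hs.trans hst) htr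
  have hsmall := (hL1 (‖x‖ + r)).eventually_lt_const (show 0 < K' * ε / 4 by positivity)
  filter_upwards [hinit x s t hst (ε / 2) (by linarith), hsmall, eventually_ge_atTop 2]
    with n h1 h2 hn
  have hn0 : (0 : ℝ) < n := by exact_mod_cast (by omega : 0 < n)
  have hnm : (0 : ℝ) < ((n - m n : ℕ) : ℝ) := by
    have := hmlt n hn
    exact_mod_cast (by omega : 0 < n - m n)
  have h3 := hcomp x (‖x‖ + r) le_rfl _ _ (fun k => Z n (m n) k ω) (fun k => Z n 0 k ω)
  rw [div_lt_iff₀ hn0] at h2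
  set F : ℝ := ∑ k, (Metric.ball x r).indicator (fun _ => (1 : ℝ)) (Z n (m n) k ω) with hF
  have hF0 : 0 ≤ F := Finset.sum_nonneg fun k _ => Set.indicator_nonneg (fun _ _ => zero_le_one) _
  -- The last row has only `n - m n` points, so normalizing by `n` instead can only lower the
  -- frequency, which is harmless for a lower bound.
  have h4 : F / n ≤ frequency (fun k => Z n (m n) k ω) (Metric.ball x r) := by
    rw [frequency]
    refine div_le_div_of_nonneg_left hF0 hnm ?_
    exact_mod_cast Nat.sub_le _ _
  refine le_trans ?_ h4
  rw [le_div_iff₀ hn0]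
  simp only [frequency] at h1
  rw [le_div_iff₀ hn0] at h1
  have h5 : K' * ((((μ : Measure ℂ).real (Metric.ball x s)) - ε) * n) ≤ K' * F := by
    have h6 := mul_le_mul_of_nonneg_left h1 hK'.le
    have h7 := h6.trans h3
    nlinarith
  exact le_of_mul_le_mul_left h5 hK'
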